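/- Let $d\ge 2$ and let $\Lambda_0\subset\mathbb R^{d-1}$ be a Bravais lattice, that is, the integer span of finitely many linearly independent vectors. Let $H\subset\mathbb R^{d-1}$ be a finite set such that $\Lambda_0$ has the same symmetries as $H$: for all $x,y,w,z\in H$ with $x\ne y$ and $w\ne z$ there is a bijection $\phi:\Lambda_0\to\Lambda_0$ with $|p+x-y|=|\phi(p)+w-z|$ for all $p\in\Lambda_0$. Let $t>0$ and $\alpha>0$. For $\mathbf s:\mathbb Z\to H$ put $\mathbf s_\tau(k)=(\mathbf s(k),kt)\in\mathbb R^{d-1}\times\mathbb R=\mathbb R^d$ and $$\Lambda_{\mathbf s}=\bigcup_{k\in\mathbb Z}\bigl(\mathbf s_\tau(k)+\Lambda_0\times\{0\}\bigr).$$ For periodic $\mathbf s$ let $\theta_{\Lambda_{\mathbf s}}(\alpha)$ be the average Gaussian energy per point, $$\theta_{\Lambda_{\mathbf s}}(\alpha)=\frac1P\sum_{h=1}^{P}\ \sum_{p\in\Lambda_{\mathbf s}}e^{-\pi\alpha|p-\mathbf s_\tau(h)|^2},$$ where $P\ge 1$ is any period of $\mathbf s$ (the value does not depend on $P$). Let $\mathcal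 B$ be the set of all $|H|$-periodic maps $\mathbf s_b:\mathbb Z\to H$ whose restriction to $\{1,\dots,|H|\}$ is a bijection $b$ onto $H$. Then the Gaussian sums $\sum_{p\in\Lambda_{\mathbf s}}e^{-\pi\alpha|p-x|^2}$ converge for all $\mathbf s:\mathbb Z\to H$ and $x\in\mathbb R^d$, and the following hold. 1. If $\alpha\ge\frac1{2\pi t^2}$, then every $\mathbf s_b\in\mathcal B$ minimizes $\mathbf s\mapsto\theta_{\Lambda_{\mathbf s}}(\alpha)$ among all periodic maps $\mathbf s:\mathbb Z\to H$. 2. If $\alpha>\frac1{2\pi t^2}$, then these are the only minimizing layerings: if a periodic $\mathbf s$ is a minimizer, then $\Lambda_{\mathbf s}=\Lambda_{\mathbf s_b}$ for some $\mathbf s_b\in\mathcal B$. If moreover no two distinct elements of $H$ differ by an element of $\Lambda_0$, then $\mathbf s\in\mathcal B$. 3. For every $\alpha>0$, every $\mathbf s_b\in\mathcal B$ minimizes $\mathbf s\mapsto\theta_{\Lambda_{\mathbf s}}(\alpha)$ among all $\mathbf s:\mathbb Z\to H$ that have a period $k'$ with $1\le k'\le|H|$. In particular, $\theta_{FCC}(\alpha)<\theta_{HCP}(\alpha)$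 for every $\alpha>0$ when FCC and HCP have the same density. Here FCC is $c\,\Lambda_{FCC}$ with $c>0$ and $\Lambda_{FCC}=\bigcup_\tau(\mathbb Z^3+\tau)$, where $\tau\in\{(0,0,0),(\tfrac12,\tfrac12,0),(\tfrac12,0,\tfrac12),(0,\tfrac12,\tfrac12)\}$, and $\theta_{FCC}(\alpha)=\sum_{p\in c\Lambda_{FCC}}e^{-\pi\alpha|p|^2}$. HCP is the configuration $\Lambda_{\mathbf s}$ over the lattice $\Lambda_0=\ell A_2$, where $A_2$ is generated by $(1,0)$ and $(\tfrac12,\tfrac{\sqrt3}2)$, with $\ell,t>0$, $\ell/t=\sqrt3/\sqrt2$, $\mathbf s(k)=0$ for even $k$ and $\mathbf s(k)=\ell\,(\tfrac12,\tfrac1{2\sqrt3})$ for odd $k$, and $\theta_{HCP}(\alpha)$ is its average energy per point as above. Equality of densities means $\frac{c^3}4=\frac{\sqrt3}2\,t\,\ell^2$. -/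

import Mathlib

namespace LayeredTheta

/-- A Bravais lattice: the integer span of finitely many linearly independent vectors
(the rank may be smaller than the dimension of the space). -/
def IsBravaisLattice {n : ℕ} (Λ₀ : Submodule ℤ (EuclideanSpace ℝ (Fin n))) : Prop :=
  ∃ (k : ℕ) (v : Fin k → EuclideanSpace ℝ (Fin n)),
    LinearIndependent ℝ v ∧ Λ₀ = Submodule.span ℤ (Set.range v)

/-- `Λ₀` has the same symmetries as `H`: for all `x ≠ y` and `w ≠ z` in `H` there is a bijection
`φ : Λ₀ → Λ₀` with `|p + x - y| = |φ p + w - z|` for all `p`. -/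
def SameSymmetries {n : ℕ} (Λ₀ : Submodule ℤ (EuclideanSpace ℝ (Fin n)))
    (H : Finset (EuclideanSpace ℝ (Fin n))) : Prop :=
  ∀ x ∈ H, ∀ y ∈ H, ∀ w ∈ H, ∀ z ∈ H, x ≠ y → w ≠ z →
    ∃ φ : Λ₀ ≃ Λ₀, ∀ p : Λ₀,
      ‖(p : EuclideanSpace ℝ (Fin n)) + x - y‖ = ‖(φ p : EuclideanSpace ℝ (Fin n)) + w - z‖

/-- `ℝ^{n+1}` with its Euclidean norm, written as the sum of the horizontal space `ℝ^n` and the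
vertical line. -/
abbrev Ambient (n : ℕ) : Type := WithLp 2 (EuclideanSpace ℝ (Fin n) × ℝ)

/-- The base point `s(k) + k τ` of the `k`-th layer, where `τ` is the vertical vector of
length `t`. -/
def basePoint {n : ℕ} (t : ℝ) (s : ℤ → EuclideanSpace ℝ (Fin n)) (k : ℤ) : Ambient n :=
  WithLp.toLp 2 (s k, (k : ℝ) * t)

/-- The layered configuration `Λ_s = ⋃ₖ (s(k) + k τ + Λ₀)`. -/
def layering {n : ℕ} (Λ₀ : Submodule ℤ (EuclideanSpace ℝ (Fin n))) (t : ℝ)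
    (s : ℤ → EuclideanSpace ℝ (Fin n)) : Set (Ambient n) :=
  Set.range fun q : ℤ × Λ₀ =>
    basePoint t s q.1 + WithLp.toLp 2 ((q.2 : EuclideanSpace ℝ (Fin n)), (0 : ℝ))

/-- The Gaussian interaction `∑_{p ∈ C} exp (-π α |p - x|²)` of the point `x` with the
configuration `C`. -/
noncomputable def pointEnergy {V : Type*} [NormedAddCommGroup V] (C : Set V) (α : ℝ) (x : V) : ℝ :=
  ∑' p : C, Real.exp (-Real.pi * α * ‖(p : V) - x‖ ^ 2)

/-- The theta function `θ_C(α) = ∑_{p ∈ C} exp (-π α |p|²)`, used for Bravais lattices `C`. -/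
noncomputable def theta {V : Type*} [NormedAddCommGroup V] (C : Set V) (α : ℝ) : ℝ :=
  pointEnergy C α 0

/-- The average over the layers `1, …, P` of the energy of the points of the layer in `Λ_s`.
As `Λ_s` is invariant under `Λ₀`, all points of one layer have the same energy, and each layer is
represented by its base point. -/
noncomputable def averageTheta {n : ℕ} (Λ₀ : Submodule ℤ (EuclideanSpace ℝ (Fin n))) (t α : ℝ)
    (s : ℤ → EuclideanSpace ℝ (Fin n)) (P : ℕ) : ℝ :=
  1 / (P : ℝ) * ∑ h ∈ Finset.range P,
    pointEnergy (layering Λ₀ t s) α (basePoint t s ((h : ℤ) + 1))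

/-- `s` has some positive integer period. -/
def IsPeriodic {X : Type*} (s : ℤ → X) : Prop :=
  ∃ P : ℕ, 0 < P ∧ Function.Periodic s (P : ℤ)

/-- The average energy per point `θ_{Λ_s}(α)` of the layered configuration of a periodic `s`,
computed with the least positive period of `s`. By `layeredTheta_eq` below every positive period
gives the same value. -/
noncomputable def layeredTheta {n : ℕ} (Λ₀ : Submodule ℤ (EuclideanSpace ℝ (Fin n))) (t α : ℝ)
    (s : ℤ → EuclideanSpace ℝ (Fin n)) : ℝ :=
  averageTheta Λ₀ t α s (sInf {P : ℕ | 0 < P ∧ Function.Periodic s (P : ℤ)})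

/-- The energy of the layer `h` is a periodic function of `h`. -/
theorem pointEnergy_periodic {n : ℕ} (Λ₀ : Submodule ℤ (EuclideanSpace ℝ (Fin n))) (t α : ℝ)
    (s : ℤ → EuclideanSpace ℝ (Fin n)) (P : ℤ) (hs : Function.Periodic s P) :
    Function.Periodic (fun h : ℤ => pointEnergy (layering Λ₀ t s) α (basePoint t s h)) P := by
  have hbase : ∀ h : ℤ, basePoint t s (h + P) =
      basePoint t s h + WithLp.toLp 2 ((0 : EuclideanSpace ℝ (Fin n)), (P : ℝ) * t) := by
    intro h
    unfold basePoint
    rw [hs h, ← WithLp.toLp_add, Prod.mk_add_mk, add_zero]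
    congr 2
    push_cast
    ring
  set v : Ambient n := WithLp.toLp 2 ((0 : EuclideanSpace ℝ (Fin n)), (P : ℝ) * t) with hv
  have hmem : ∀ p : Ambient n, p ∈ layering Λ₀ t s ↔ p + v ∈ layering Λ₀ t s := by
    intro p
    constructor
    · rintro ⟨q, rfl⟩
      refine ⟨(q.1 + P, q.2), ?_⟩
      simp only [hbase]
      abel
    · rintro ⟨q, hq⟩
      refine ⟨(q.1 - P, q.2), ?_⟩
      have h1 := hbase (q.1 - P)
      rw [sub_add_cancel] at h1
      simp only [h1] at hq
      apply add_right_cancel (b := v)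
      rw [← hq]
      simp only
      abel
  intro h
  unfold pointEnergy
  let e : layering Λ₀ t s ≃ layering Λ₀ t s := (Equiv.addRight v).subtypeEquiv hmem
  simp only [hbase]
  rw [← e.tsum_eq]
  refine tsum_congr fun p => ?_
  have he : ((e p : layering Λ₀ t s) : Ambient n) = (p : Ambient n) + v := rfl
  rw [he, add_sub_add_right_eq_sub]

/-- Sums of a periodic function over consecutive periods. -/
theorem sum_range_mul_of_periodic (g : ℤ → ℝ) (P : ℕ) (hg : Function.Periodic g (P : ℤ)) (m : ℕ) :
    ∑ h ∈ Finset.range (m * P), g ((h : ℤ) + 1) = m * ∑ h ∈ Finset.range P, g ((h : ℤ) + 1) := by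
  induction m with
  | zero => simp
  | succ m ih =>
    rw [Nat.succ_mul, Finset.sum_range_add, ih]
    have : ∀ h : ℕ, g (((m * P + h : ℕ) : ℤ) + 1) = g ((h : ℤ) + 1) := by
      intro h
      have := hg.nat_mul m ((h : ℤ) + 1)
      rw [← this]
      congr 1
      push_cast
      ring
    simp only [this]
    push_cast
    ring

/-- The average energy per point does not depend on the period used to compute it. -/
theorem layeredTheta_eq {n : ℕ} (Λ₀ : Submodule ℤ (EuclideanSpace ℝ (Fin n))) (t α : ℝ)
    (s : ℤ → EuclideanSpace ℝ (Fin n)) (P : ℕ) (hP : 0 < P)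
    (hs : Function.Periodic s (P : ℤ)) :
    layeredTheta Λ₀ t α s = averageTheta Λ₀ t α s P := by
  unfold layeredTheta
  have hQ := Nat.sInf_mem (s := {P : ℕ | 0 < P ∧ Function.Periodic s (P : ℤ)}) ⟨P, hP, hs⟩
  set Q := sInf {P : ℕ | 0 < P ∧ Function.Periodic s (P : ℤ)}
  obtain ⟨hQ0, hQs⟩ := hQ
  have h1 := sum_range_mul_of_periodic _ P (pointEnergy_periodic Λ₀ t α s P hs) Q
  have h2 := sum_range_mul_of_periodic _ Q (pointEnergy_periodic Λ₀ t α s Q hQs) P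
  rw [mul_comm P Q, h1] at h2
  unfold averageTheta
  have hP' : (P : ℝ) ≠ 0 := by exact_mod_cast hP.ne'
  have hQ' : (Q : ℝ) ≠ 0 := by exact_mod_cast hQ0.ne'
  field_simp
  linarith

/-- `s` is one of the maps `s_b`: it is `|H|`-periodic and its restriction to `{1, …, |H|}` is a
bijection onto `H`. -/
def IsBijectiveLayering {X : Type*} (H : Finset X) (s : ℤ → H) : Prop :=
  Function.Periodic s (H.card : ℤ) ∧ Set.BijOn s (Set.Icc 1 (H.card : ℤ)) Set.univ

/-- Among the maps `ℤ → H` in the class `S`, the map `b` minimizes `s ↦ θ_{Λ_s}(α)`. -/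
def MinimizesTheta {n : ℕ} (Λ₀ : Submodule ℤ (EuclideanSpace ℝ (Fin n))) (t α : ℝ)
    {H : Finset (EuclideanSpace ℝ (Fin n))} (S : Set (ℤ → H)) (b : ℤ → H) : Prop :=
  b ∈ S ∧ ∀ s ∈ S, layeredTheta Λ₀ t α (fun k => (b k : EuclideanSpace ℝ (Fin n))) ≤
    layeredTheta Λ₀ t α (fun k => (s k : EuclideanSpace ℝ (Fin n)))

/-- The face-centred cubic lattice: the union of the translates of `ℤ³` by `(0,0,0)`,
`(1/2,1/2,0)`, `(1/2,0,1/2)` and `(0,1/2,1/2)`. It has four points per unit volume. -/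
def fcc : Set (EuclideanSpace ℝ (Fin 3)) :=
  {x | ∃ τ ∈ ({!₂[0, 0, 0], !₂[1 / 2, 1 / 2, 0], !₂[1 / 2, 0, 1 / 2], !₂[0, 1 / 2, 1 / 2]} :
      Set (EuclideanSpace ℝ (Fin 3))), ∀ i, ∃ m : ℤ, x i - τ i = m}

/-- The face-centred cubic lattice with cubic cell of side `c`. -/
def scaledFcc (c : ℝ) : Set (EuclideanSpace ℝ (Fin 3)) :=
  (fun x => c • x) '' fcc

/-- The triangular lattice `ℓ A₂` generated by `ℓ (1, 0)` and `ℓ (1/2, √3/2)`. -/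
noncomputable def triangular (ℓ : ℝ) : Submodule ℤ (EuclideanSpace ℝ (Fin 2)) :=
  Submodule.span ℤ {ℓ • !₂[1, 0], ℓ • !₂[1 / 2, √3 / 2]}

/-- The shifts of the hexagonal close packing: `0` on even layers and `ℓ (1/2, 1/(2√3))` on odd
layers. -/
noncomputable def hcpShift (ℓ : ℝ) (k : ℤ) : EuclideanSpace ℝ (Fin 2) :=
  if Even k then 0 else ℓ • !₂[1 / 2, 1 / (2 * √3)]

end LayeredTheta

/-!
The energy of layer `h` of `Λ_s` is `∑ⱼ exp (-π α t² j²) F (s (h + j) - s h)`, where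
`F u = ∑_{p ∈ Λ₀} exp (-π α |p + u|²)` (`hasSum_layer`). By the symmetry hypothesis `F` takes only
two values on differences of elements of `H`: `A = F 0` and a common value `B`. Hence the average
energy is `B · const + (A - B) · R`, where `R` is the average over `h` of the weights
`exp (-π α t² j²)` of the distances `j` with `s (h + j) = s h` (`layeredTheta_eq_recurrence`).

*Comparison of `A` and `B`.* `F u ≤ F 0`, strictly if `u ∉ Λ₀` (`shiftedTheta_le`,
`shiftedTheta_lt`). This follows without Fourier analysis from a duplication formula: by the
parallelogram identity `F u * F v` is a sum over `Λ₀ / 2 Λ₀` of products of Gaussian sums with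
parameter `2 α` (`hasSum_duplication`), and completing squares gives
`0 ≤ F (2 u) F 0 - 2 (F u)² + (F 0)²`. As `F` is bounded, the supremum `M` of `F / F 0` satisfies
`2 M² ≤ M + 1`, so `M ≤ 1`. Equality at `u` passes to the parameters `2 ^ m α`, whose limit
excludes `u ∉ Λ₀`.

*Recurrences.* It remains to minimize `R`. The `r`-th return times of a periodic `s` have average
at most `r |H|` (`sum_returnTime_le`), and `x ↦ exp (-β x²)` is decreasing and, for
`β = π α t² ≥ 1/2`, strictly convex on `[1, ∞)`, which contains all return times. Jensen's
inequality therefore bounds the `r`-th contribution from below by its value for the bijective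
layerings, whose `r`-th return times are all `r |H|` (`le_sum_recurrenceEnergy`); equality for
`r = 1` forces every first return time to be `|H|`. If `s` has a period `k' ≤ |H|`, then all
multiples of `k'` are recurrences, and they already weigh at least as much as the multiples of
`|H|`, for every `α`.

*Face-centred cubic against hexagonal close packing.* Both are layerings over the same triangular
lattice with the same two values `A > B`; the layers recur at the multiples of `3` and of `2`,
respectively (`theta_fcc_lt_hcp`).
-/

namespace LayeredTheta

/-! ### Gaussian sums over translates of a lattice -/

section LatticeGaussian

variable {E : Type*} [NormedAddCommGroup E]

/-- The Gaussian sum `∑_{p ∈ L} exp (-π α |p + u|²)` of the translate `L + u`. -/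
noncomputable def shiftedTheta (L : Submodule ℤ E) (α : ℝ) (u : E) : ℝ :=
  ∑' p : L, Real.exp (-Real.pi * α * ‖(p : E) + u‖ ^ 2)

/-- All Gaussian sums over translates of `L` converge. -/
def GaussSummable (L : Submodule ℤ E) : Prop :=
  ∀ α : ℝ, 0 < α → ∀ u : E, Summable fun p : L => Real.exp (-Real.pi * α * ‖(p : E) + u‖ ^ 2)

theorem exp_neg_sq_le (a y : ℝ) (ha : 0 < a) (hy : y ≠ 0) (M : ℕ) :
    Real.exp (-(a * y ^ 2)) ≤ (M.factorial / a ^ M) * y⁻¹ ^ (2 * M) := by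
  have h := Real.pow_div_factorial_le_exp (a * y ^ 2) (by positivity) M
  have hM : (0 : ℝ) < M.factorial := by positivity
  have hy2 : 0 < y ^ 2 := by positivity
  rw [Real.exp_neg, inv_le_iff_one_le_mul₀ (Real.exp_pos _)]
  calc (1 : ℝ) = (M.factorial / a ^ M * y⁻¹ ^ (2 * M)) * ((a * y ^ 2) ^ M / M.factorial) := by
        rw [mul_pow, ← pow_mul, inv_pow]
        field_simp
    _ ≤ _ := by
        refine mul_le_mul_of_nonneg_left h ?_
        rw [pow_mul]
        positivity

/-- A discrete subgroup of a finite-dimensional space has convergent Gaussian sums. -/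
theorem gaussSummable_of_discrete [InnerProductSpace ℝ E]
    [FiniteDimensional ℝ E] (L : Submodule ℤ E)
    [DiscreteTopology L] : GaussSummable L := by
  intro α hα u
  have hs := (ZLattice.summable_norm_sub_inv_pow L (2 * (Module.finrank ℤ L + 1)) (by omega)
    (-u)).mul_left (((Module.finrank ℤ L + 1).factorial : ℝ) /
      (Real.pi * α) ^ (Module.finrank ℤ L + 1))
  refine Summable.of_norm_bounded_eventually hs ?_
  have hfin : {p : L | (p : E) + u = 0}.Finite := by
    apply Set.Subsingleton.finite
    intro p hp q hq
    apply Subtype.ext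
    exact add_right_cancel (hp.trans hq.symm)
  filter_upwards [hfin.compl_mem_cofinite] with p hp
  have hp' : ‖(p : E) + u‖ ≠ 0 := norm_ne_zero_iff.mpr hp
  rw [Real.norm_of_nonneg (Real.exp_nonneg _), sub_neg_eq_add]
  have := exp_neg_sq_le (Real.pi * α) _ (by positivity) hp' (Module.finrank ℤ L + 1)
  convert this using 2
  ring

/-- The integer span of a linearly independent family is contained in the integer span of a
basis, hence discrete. -/
theorem discreteTopology_span_of_linearIndependent [InnerProductSpace ℝ E]
    [FiniteDimensional ℝ E] {k : ℕ}
    {v : Fin k → E} (hv : LinearIndependent ℝ v) :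
    DiscreteTopology (Submodule.span ℤ (Set.range v)) := by
  let b := Module.Basis.extend hv.linearIndepOn_id
  have hb : Set.range v ⊆ Set.range b := by
    rw [Module.Basis.range_extend]
    exact hv.linearIndepOn_id.subset_extend _
  have : Finite (hv.linearIndepOn_id.extend (Set.subset_univ (Set.range v))) :=
    Module.Finite.finite_basis b
  exact DiscreteTopology.of_subset (s := (Submodule.span ℤ (Set.range b) : Set E))
    (inferInstanceAs (DiscreteTopology (Submodule.span ℤ (Set.range b))))
    (Submodule.span_mono hb)

variable {L : Submodule ℤ E} {α : ℝ}

theorem shiftedTheta_nonneg (L : Submodule ℤ E) (α : ℝ) (u : E) : 0 ≤ shiftedTheta L α u :=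
  tsum_nonneg fun _ => (Real.exp_pos _).le

theorem shiftedTheta_pos (hL : GaussSummable L) (hα : 0 < α) (u : E) :
    0 < shiftedTheta L α u :=
  (hL α hα u).tsum_pos (fun _ => (Real.exp_pos _).le) 0 (Real.exp_pos _)

theorem shiftedTheta_add_mem (u : E) {p : E} (hp : p ∈ L) :
    shiftedTheta L α (u + p) = shiftedTheta L α u := by
  unfold shiftedTheta
  rw [← (Equiv.addRight (⟨p, hp⟩ : L)).tsum_eq
    (fun q : L => Real.exp (-Real.pi * α * ‖(q : E) + u‖ ^ 2))]
  refine tsum_congr fun q => ?_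
  simp only [Equiv.coe_addRight, Submodule.coe_add]
  congr 4
  abel

theorem shiftedTheta_neg (u : E) : shiftedTheta L α (-u) = shiftedTheta L α u := by
  unfold shiftedTheta
  rw [← (Equiv.neg L).tsum_eq]
  refine tsum_congr fun q => ?_
  simp only [Equiv.neg_apply, Submodule.coe_neg]
  rw [← neg_add, norm_neg]

/-- The translate of `L` by `-u` has a point closest to the origin. -/
theorem exists_nearest (hL : GaussSummable L) (u : E) :
    ∃ p₀ : L, ∀ p : L, ‖(p₀ : E) + u‖ ≤ ‖(p : E) + u‖ := by
  have h0 := (hL 1 one_pos u).tendsto_cofinite_zero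
  have hfin : {p : L | ‖(p : E) + u‖ ≤ ‖u‖}.Finite := by
    have := h0.eventually_lt_const (Real.exp_pos (-Real.pi * 1 * ‖u‖ ^ 2))
    rw [Filter.eventually_cofinite] at this
    refine this.subset fun p hp => ?_
    simp only [Set.mem_ofPred_eq, not_lt] at hp ⊢
    apply Real.exp_le_exp.mpr
    have : ‖(p : E) + u‖ ^ 2 ≤ ‖u‖ ^ 2 := by gcongr
    nlinarith [Real.pi_pos]
  obtain ⟨p₀, hp₀, hmin⟩ := Set.exists_min_image _ (fun p : L => ‖(p : E) + u‖) hfin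
    ⟨0, by simp⟩
  refine ⟨p₀, fun p => ?_⟩
  by_cases hp : ‖(p : E) + u‖ ≤ ‖u‖
  · exact hmin p hp
  · exact le_trans hp₀ (not_le.mp hp).le

/-- The shifted theta function is bounded: after moving `u` by a lattice point so that no point of
`L + u` is closer to the origin than `u`, one has `|p| ≤ 2 |p + u|` for all `p`. -/
theorem shiftedTheta_le_bound (hL : GaussSummable L) (hα : 0 < α) (u : E) :
    shiftedTheta L α u ≤ shiftedTheta L (α / 4) 0 := by
  obtain ⟨p₀, hp₀⟩ := exists_nearest hL u
  rw [← shiftedTheta_add_mem u p₀.2]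
  refine (hL α hα _).tsum_le_tsum (fun p => ?_) (hL (α / 4) (by positivity) 0)
  apply Real.exp_le_exp.mpr
  have h1 := hp₀ (p + p₀)
  rw [Submodule.coe_add] at h1
  have h2 : ‖(p : E)‖ ≤ 2 * ‖(p : E) + (u + p₀)‖ := by
    have h3 : (p : E) = ((p : E) + (u + p₀)) - ((p₀ : E) + u) := by abel
    have h4 : (p : E) + p₀ + u = (p : E) + (u + p₀) := by abel
    rw [h4] at h1
    calc ‖(p : E)‖ = ‖((p : E) + (u + p₀)) - ((p₀ : E) + u)‖ := by rw [← h3]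
      _ ≤ _ := norm_sub_le _ _
      _ ≤ _ := by linarith
  have h3 : ‖(p : E)‖ ^ 2 ≤ 4 * ‖(p : E) + (u + p₀)‖ ^ 2 := by
    nlinarith [norm_nonneg (p : E)]
  rw [add_zero]
  nlinarith [mul_pos Real.pi_pos hα]

variable [InnerProductSpace ℝ E]

/-- The classes of `L` modulo `2 L`. -/
abbrev ModTwo {E : Type*} [NormedAddCommGroup E] (L : Submodule ℤ E) : Type _ :=
  L ⧸ (nsmulAddMonoidHom (α := L) 2).range

/-- The bijection `(c, a, b) ↦ (a + b + r c, a - b)`, where `r c` represents the class `c` modulo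
`2 L`; it inverts `(p, q) ↦ (p + q, p - q)`. -/
noncomputable def doublingEquiv (L : Submodule ℤ E) : ModTwo L × L × L ≃ L × L :=
  Equiv.ofBijective (fun x => (x.2.1 + x.2.2 + Quotient.out x.1, x.2.1 - x.2.2)) <| by
    have cancel : ∀ a b : L, 2 • a = 2 • b → a = b := by
      intro a b h
      have h' : (2 : ℝ) • (a : E) = (2 : ℝ) • (b : E) := by
        have := congrArg (Subtype.val) h
        simpa [two_smul] using this
      exact Subtype.ext (smul_right_injective E (two_ne_zero' ℝ) h')
    constructor
    · rintro ⟨c, a, b⟩ ⟨c', a', b'⟩ h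
      simp only [Prod.mk.injEq] at h
      obtain ⟨h1, h2⟩ := h
      have h3 : 2 • a + Quotient.out c = 2 • a' + Quotient.out c' := by
        calc 2 • a + Quotient.out c = (a + b + Quotient.out c) + (a - b) := by abel
          _ = (a' + b' + Quotient.out c') + (a' - b') := by rw [h1, h2]
          _ = _ := by abel
      have hc : c = c' := by
        rw [← Quotient.out_eq c, ← Quotient.out_eq c']
        refine (QuotientAddGroup.eq (s := (nsmulAddMonoidHom (α := L) 2).range)).mpr
          ⟨a - a', ?_⟩
        rw [nsmulAddMonoidHom_apply, smul_sub, neg_add_eq_sub]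
        rw [sub_eq_sub_iff_add_eq_add, h3, add_comm]
      subst hc
      have ha : a = a' := cancel _ _ (add_right_cancel h3)
      subst ha
      have hb : b = b' := sub_right_injective h2
      rw [hb]
    · rintro ⟨p, q⟩
      obtain ⟨x, hx⟩ : ∃ x : L, 2 • x =
          -(Quotient.out ((p + q : L) : ModTwo L)) + (p + q) := by
        have := (QuotientAddGroup.eq (s := (nsmulAddMonoidHom (α := L) 2).range)).mp
          (Quotient.out_eq ((p + q : L) : ModTwo L))
        exact this
      refine ⟨((p + q : L), x, x - q), ?_⟩
      simp only [Prod.mk.injEq]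
      constructor
      · have : x + (x - q) + Quotient.out ((p + q : L) : ModTwo L) =
          2 • x - q + Quotient.out ((p + q : L) : ModTwo L) := by abel
        rw [this, hx]
        abel
      · abel

theorem doublingEquiv_apply (L : Submodule ℤ E) (c : ModTwo L) (a b : L) :
    doublingEquiv L (c, a, b) = (a + b + Quotient.out c, a - b) := rfl

/-- Duplication formula: the parallelogram identity turns a product of two Gaussian sums into a
sum over `L / 2 L` of products of Gaussian sums with doubled parameter. -/
theorem hasSum_duplication (hL : GaussSummable L) (hα : 0 < α) (x y : E) :
    HasSum (fun c : ModTwo L =>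
      shiftedTheta L (2 * α) ((2⁻¹ : ℝ) • ((Quotient.out c : L) : E) + x) *
        shiftedTheta L (2 * α) ((2⁻¹ : ℝ) • ((Quotient.out c : L) : E) + y))
      (shiftedTheta L α (x + y) * shiftedTheta L α (x - y)) := by
  have h2α : 0 < 2 * α := by positivity
  have hprod := ((hL α hα (x + y)).mul_of_nonneg (hL α hα (x - y))
    (fun _ => (Real.exp_pos _).le) (fun _ => (Real.exp_pos _).le))
  have h1 := hprod.hasSum
  rw [← (hL α hα (x + y)).tsum_mul_tsum (hL α hα (x - y)) hprod,
    ← (doublingEquiv L).hasSum_iff] at h1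
  refine h1.prod_fiberwise fun c => ?_
  have hX := hL (2 * α) h2α ((2⁻¹ : ℝ) • ((Quotient.out c : L) : E) + x)
  have hY := hL (2 * α) h2α ((2⁻¹ : ℝ) • ((Quotient.out c : L) : E) + y)
  have hXY := hX.mul_of_nonneg hY (fun _ => (Real.exp_pos _).le) (fun _ => (Real.exp_pos _).le)
  have h3 := hXY.hasSum
  rw [← hX.tsum_mul_tsum hY hXY] at h3
  refine HasSum.congr_fun h3 fun q => ?_
  obtain ⟨a, b⟩ := q
  simp only [Function.comp_apply, doublingEquiv_apply, Submodule.coe_add, Submodule.coe_sub]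
  rw [← Real.exp_add, ← Real.exp_add]
  congr 1
  set r : E := ((Quotient.out c : L) : E)
  have hr : r = (2⁻¹ : ℝ) • r + (2⁻¹ : ℝ) • r := by
    rw [← add_smul]
    norm_num
  have e1 : (a : E) + b + r + (x + y) =
      ((a : E) + ((2⁻¹ : ℝ) • r + x)) + ((b : E) + ((2⁻¹ : ℝ) • r + y)) := by
    nth_rewrite 1 [hr]
    abel
  have e2 : (a : E) - b + (x - y) =
      ((a : E) + ((2⁻¹ : ℝ) • r + x)) - ((b : E) + ((2⁻¹ : ℝ) • r + y)) := by
    abel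
  rw [e1, e2]
  have := parallelogram_law_with_norm ℝ ((a : E) + ((2⁻¹ : ℝ) • r + x))
    ((b : E) + ((2⁻¹ : ℝ) • r + y))
  linear_combination (-Real.pi * α) * this

/-- The duplication formula, expanded into a sum of squares over `L / 2 L`. -/
theorem hasSum_sq_duplication (hL : GaussSummable L) (hα : 0 < α) (u : E) :
    HasSum (fun c : ModTwo L =>
      (shiftedTheta L (2 * α) ((2⁻¹ : ℝ) • ((Quotient.out c : L) : E) + u) -
        shiftedTheta L (2 * α) ((2⁻¹ : ℝ) • ((Quotient.out c : L) : E) + 0)) ^ 2)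
      (shiftedTheta L α (u + u) * shiftedTheta L α 0 - 2 * shiftedTheta L α u ^ 2 +
        shiftedTheta L α 0 ^ 2) := by
  have h1 := hasSum_duplication hL hα u u
  have h2 := hasSum_duplication hL hα u 0
  have h3 := hasSum_duplication hL hα (0 : E) 0
  simp only [sub_self, sub_zero] at h1 h2 h3
  rw [add_zero] at h2 h3
  have e : ∀ a b c : ℝ, a * c - 2 * b ^ 2 + c ^ 2 = a * c - 2 * (b * b) + c * c := by
    intro a b c
    ring
  rw [e]
  refine HasSum.congr_fun ((h1.sub (h2.mul_left 2)).add h3) fun c => ?_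
  ring

/-- A shifted theta function is largest at the lattice points. If `M` is the supremum of
`f u = F u / F 0`, then `2 (f u)² ≤ f (2 u) + 1 ≤ M + 1` gives `2 M² ≤ M + 1`, so `M ≤ 1`. -/
theorem shiftedTheta_le (hL : GaussSummable L) (hα : 0 < α) (u : E) :
    shiftedTheta L α u ≤ shiftedTheta L α 0 := by
  have hbdd : BddAbove (Set.range (shiftedTheta L α)) :=
    ⟨_, by rintro _ ⟨v, rfl⟩; exact shiftedTheta_le_bound hL hα v⟩
  set A := shiftedTheta L α 0 with hA
  have hA0 : 0 < A := shiftedTheta_pos hL hα 0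
  set M := ⨆ v, shiftedTheta L α v with hM
  have hle : ∀ v, shiftedTheta L α v ≤ M := le_ciSup hbdd
  have hM0 : 0 < M := hA0.trans_le (hle 0)
  have key : ∀ v, shiftedTheta L α v ≤ √((M * A + A ^ 2) / 2) := by
    intro v
    apply Real.le_sqrt_of_sq_le
    have h1 := (hasSum_sq_duplication hL hα v).nonneg fun _ => sq_nonneg _
    rw [← hA] at h1
    nlinarith [mul_le_mul_of_nonneg_right (hle (v + v)) hA0.le]
  have h2 : M ≤ √((M * A + A ^ 2) / 2) := ciSup_le key
  have h3 : M ^ 2 ≤ (M * A + A ^ 2) / 2 :=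
    (Real.le_sqrt hM0.le (by positivity)).mp h2
  have h4 : M ≤ A := by
    by_contra hlt
    push Not at hlt
    nlinarith
  exact (hle u).trans h4

/-- Equality at `u` propagates to twice the parameter. -/
theorem shiftedTheta_two_mul_eq (hL : GaussSummable L) (hα : 0 < α) {u : E}
    (h : shiftedTheta L α u = shiftedTheta L α 0) :
    shiftedTheta L (2 * α) u = shiftedTheta L (2 * α) 0 := by
  have hsum := hasSum_sq_duplication hL hα u
  have hA0 : 0 < shiftedTheta L α 0 := shiftedTheta_pos hL hα 0
  have hle := shiftedTheta_le hL hα (u + u)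
  rw [h] at hsum
  have h0 := hsum.nonneg fun _ => sq_nonneg _
  have hz : shiftedTheta L α (u + u) * shiftedTheta L α 0 - 2 * shiftedTheta L α 0 ^ 2 +
      shiftedTheta L α 0 ^ 2 = 0 := by nlinarith
  rw [hz, hasSum_zero_iff_of_nonneg fun _ => sq_nonneg _] at hsum
  have hc := congrFun hsum ((0 : L) : ModTwo L)
  simp only [Pi.zero_apply, ne_eq, OfNat.ofNat_ne_zero, not_false_eq_true, pow_eq_zero_iff,
    sub_eq_zero] at hc
  -- half of the representative of the trivial class lies in `L`
  obtain ⟨x, hx⟩ : ∃ x : L, 2 • x = Quotient.out ((0 : L) : ModTwo L) := by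
    obtain ⟨x, hx⟩ := (QuotientAddGroup.eq (s := (nsmulAddMonoidHom (α := L) 2).range)).mp
      (Quotient.out_eq ((0 : L) : ModTwo L)).symm
    refine ⟨x, ?_⟩
    simpa using hx
  have hx' : (2⁻¹ : ℝ) • ((Quotient.out ((0 : L) : ModTwo L) : L) : E) = x := by
    rw [← hx, two_smul, Submodule.coe_add, ← two_smul ℝ, smul_smul]
    norm_num
  rw [hx', add_comm, add_comm (x : E), shiftedTheta_add_mem _ x.2,
    shiftedTheta_add_mem _ x.2] at hc
  exact hc

/-- Away from the lattice the inequality `shiftedTheta_le` is strict: equality would persist for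
the parameters `2 ^ m α`, while `F 0 ≥ 1` and `F u → 0` as the parameter grows. -/
theorem shiftedTheta_lt (hL : GaussSummable L) (hα : 0 < α) {u : E} (hu : u ∉ L) :
    shiftedTheta L α u < shiftedTheta L α 0 := by
  refine lt_of_le_of_ne (shiftedTheta_le hL hα u) fun h => ?_
  have hall : ∀ m : ℕ, shiftedTheta L (2 ^ m * α) u = shiftedTheta L (2 ^ m * α) 0 := by
    intro m
    induction m with
    | zero => simpa using h
    | succ m ih =>
      have := shiftedTheta_two_mul_eq hL (by positivity) ih
      rw [pow_succ', mul_assoc]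
      exact this
  have hone : ∀ m : ℕ, 1 ≤ shiftedTheta L (2 ^ m * α) u := by
    intro m
    rw [hall m]
    have := (hL (2 ^ m * α) (by positivity) 0).le_tsum 0 fun _ _ => (Real.exp_pos _).le
    simpa [shiftedTheta] using this
  have hlim : Filter.Tendsto (fun m : ℕ => shiftedTheta L (2 ^ m * α) u) Filter.atTop
      (nhds (∑' _ : L, (0 : ℝ))) := by
    refine tendsto_tsum_of_dominated_convergence (hL α hα u) (fun p => ?_)
      (Filter.Eventually.of_forall fun m p => ?_)
    · have hp : (p : E) + u ≠ 0 := by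
        intro h0
        apply hu
        rw [eq_neg_of_add_eq_zero_right h0]
        exact L.neg_mem p.2
      have hn : 0 < ‖(p : E) + u‖ := norm_pos_iff.mpr hp
      apply Real.tendsto_exp_atBot.comp
      have h2 : Filter.Tendsto (fun m : ℕ => (2 : ℝ) ^ m) Filter.atTop Filter.atTop :=
        tendsto_pow_atTop_atTop_of_one_lt one_lt_two
      have h3 := h2.atTop_mul_const_of_neg
        (r := -(Real.pi * α * ‖(p : E) + u‖ ^ 2)) (by
          have := Real.pi_pos
          have : 0 < Real.pi * α * ‖(p : E) + u‖ ^ 2 := by positivity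
          linarith)
      refine h3.congr fun m => ?_
      ring
    · rw [Real.norm_of_nonneg (Real.exp_pos _).le]
      apply Real.exp_le_exp.mpr
      have h1 : (1 : ℝ) ≤ 2 ^ m := one_le_pow₀ one_le_two
      have h2 : 0 ≤ Real.pi * α * ‖(p : E) + u‖ ^ 2 := by
        have := Real.pi_pos
        positivity
      nlinarith
  rw [tsum_zero] at hlim
  have := ge_of_tendsto' hlim hone
  linarith

end LatticeGaussian

/-! ### Recurrences in periodic sequences -/

section Recurrence

/-- The Gaussian weight `exp (-β j²)` of the vertical distance `j`. -/
noncomputable def gaussWeight (β : ℝ) (j : ℤ) : ℝ := Real.exp (-β * (j : ℝ) ^ 2)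

theorem gaussWeight_pos (β : ℝ) (j : ℤ) : 0 < gaussWeight β j := Real.exp_pos _

theorem gaussWeight_neg (β : ℝ) (j : ℤ) : gaussWeight β (-j) = gaussWeight β j := by
  simp [gaussWeight]

theorem gaussWeight_summable {β : ℝ} (hβ : 0 < β) : Summable (gaussWeight β) := by
  have hs := (Real.summable_one_div_int_pow.mpr one_lt_two).mul_left (1 / β)
  refine Summable.of_norm_bounded_eventually hs ?_
  filter_upwards [(Set.finite_singleton (0 : ℤ)).compl_mem_cofinite] with j hj
  have hj' : (j : ℝ) ≠ 0 := by exact_mod_cast hj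
  rw [Real.norm_of_nonneg (gaussWeight_pos β j).le]
  have := exp_neg_sq_le β j hβ hj' 1
  simpa [gaussWeight] using this

/-- The total weight of the distances at which the value `s h` recurs. -/
noncomputable def recurrenceEnergy {X : Type*} (β : ℝ) (s : ℤ → X) (h : ℤ) : ℝ :=
  ∑' j : ℤ, {j : ℤ | s (h + j) = s h}.indicator (gaussWeight β) j

/-- The `r`-th return time of `s` to the value `s h` after `h`; the `0`-th one is `0`. -/
noncomputable def returnTime {X : Type*} (s : ℤ → X) (h : ℤ) (r : ℕ) : ℕ :=
  Nat.nth (fun j : ℕ => s (h + j) = s h) r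

theorem sum_range_add_of_periodic {M : Type*} [AddCommGroup M] {f : ℤ → M} {P : ℕ}
    (hf : Function.Periodic f (P : ℤ)) (a : ℤ) :
    ∑ h ∈ Finset.range P, f (h + a) = ∑ h ∈ Finset.range P, f h := by
  have step : ∀ a : ℤ, ∑ h ∈ Finset.range P, f (h + (a + 1)) =
      ∑ h ∈ Finset.range P, f (h + a) := by
    intro a
    have h1 := Finset.sum_range_succ (fun h : ℕ => f (h + a)) P
    have h2 := Finset.sum_range_succ' (fun h : ℕ => f (h + a)) P
    have h3 : f ((P : ℤ) + a) = f a := by rw [add_comm]; exact hf a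
    simp only [Nat.cast_add, Nat.cast_one, Nat.cast_zero, zero_add] at h1 h2
    rw [h1, h3] at h2
    have h4 := add_right_cancel h2
    rw [h4]
    refine Finset.sum_congr rfl fun h _ => ?_
    congr 1
    ring
  induction a using Int.induction_on with
  | zero => simp
  | succ a ih => rw [step, ih]
  | pred a ih => rw [← ih, ← step, sub_add_cancel]

variable {X : Type*} {s : ℤ → X} {P : ℕ}

theorem infinite_returns (hP : 0 < P) (hs : Function.Periodic s (P : ℤ)) (h : ℤ) :
    (Set.ofPred fun j : ℕ => s (h + j) = s h).Infinite := by
  refine Set.infinite_of_injective_forall_mem (f := fun m : ℕ => m * P)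
    (fun a b hab => Nat.eq_of_mul_eq_mul_right hP hab) fun m => ?_
  have := hs.nat_mul m h
  simpa using this

theorem returnTime_periodic (hs : Function.Periodic s (P : ℤ)) (r : ℕ) :
    Function.Periodic (fun h => returnTime s h r) (P : ℤ) := by
  intro h
  unfold returnTime
  have : ∀ j : ℕ, s (h + P + j) = s (h + j) := by
    intro j
    rw [add_right_comm]
    exact hs _
  simp only [this, hs h]

theorem returnTime_zero (s : ℤ → X) (h : ℤ) : returnTime s h 0 = 0 :=
  Nat.nth_zero_of_zero (by simp)

theorem le_returnTime (hP : 0 < P) (hs : Function.Periodic s (P : ℤ)) (h : ℤ) (r : ℕ) :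
    r ≤ returnTime s h r :=
  (Nat.nth_strictMono (infinite_returns hP hs h)).le_apply

/-- The `r`-th return times add up to at most `r · |X| · P` over a period: for each value, a fixed
position `x` lies in `[h, h + returnTime s h r)` for at most `r` positions `h` of that value. -/
theorem sum_returnTime_le [Fintype X] (hP : 0 < P) (hs : Function.Periodic s (P : ℤ)) (r : ℕ) :
    ∑ h ∈ Finset.range P, returnTime s h r ≤ P * (r * Fintype.card X) := by
  classical
  let cnt : ℤ → ℕ → ℕ := fun h i => Nat.count (fun j : ℕ => s (h + j) = s h) (i + 1)
  have hcnt : ∀ i, Function.Periodic (fun h => cnt h i) (P : ℤ) := by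
    intro i h
    have : ∀ j : ℕ, s (h + P + j) = s (h + j) := by
      intro j
      rw [add_right_comm]
      exact hs _
    simp only [cnt, this, hs h]
  set K := ∑ h ∈ Finset.range P, returnTime s h r with hK
  have h1 : ∀ h ∈ Finset.range P, returnTime s h r =
      ∑ i ∈ Finset.range K, if cnt h i ≤ r then 1 else 0 := by
    intro h hh
    have hle : returnTime s h r ≤ K :=
      Finset.single_le_sum (f := fun h : ℕ => returnTime s h r) (fun _ _ => Nat.zero_le _) hh
    rw [Finset.sum_boole, Nat.cast_id]
    have : (Finset.range K).filter (fun i => cnt h i ≤ r) =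
        Finset.range (returnTime s h r) := by
      ext i
      simp only [Finset.mem_filter, Finset.mem_range, cnt, returnTime,
        Nat.count_le_iff_le_nth (infinite_returns hP hs h)]
      unfold returnTime at hle
      omega
    rw [this, Finset.card_range]
  have h2 : K = ∑ h ∈ Finset.range P, ∑ i ∈ Finset.range K,
      if cnt ((h : ℤ) - i) i ≤ r then 1 else 0 := by
    conv_lhs => rw [hK, Finset.sum_congr rfl h1]
    rw [Finset.sum_comm]
    conv_rhs => rw [Finset.sum_comm]
    refine Finset.sum_congr rfl fun i _ => ?_
    have hper : Function.Periodic (fun h : ℤ => if cnt h i ≤ r then (1 : ℤ) else 0) (P : ℤ) := by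
      intro h
      have := hcnt i h
      simp only at this
      simp only [this]
    have := sum_range_add_of_periodic hper (-(i : ℤ))
    simp only [← sub_eq_add_neg] at this
    exact_mod_cast this.symm
  rw [h2]
  refine (Finset.sum_le_card_nsmul _ _ (r * Fintype.card X) fun x _ => ?_).trans (by simp)
  rw [Finset.sum_boole, Nat.cast_id]
  have hpos : ∀ (h : ℤ) (i : ℕ), 1 ≤ cnt h i := by
    intro h i
    simp only [cnt, Nat.count_succ']
    simp
  have hmono : ∀ i i' : ℕ, i < i' → s ((x : ℤ) - i) = s ((x : ℤ) - i') →
      cnt ((x : ℤ) - i) i < cnt ((x : ℤ) - i') i' := by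
    intro i i' hlt heq
    obtain ⟨d, rfl⟩ := Nat.exists_eq_add_of_lt hlt
    have e : i + d + 1 + 1 = (d + 1) + (i + 1) := by ring
    simp only [cnt]
    rw [e, Nat.count_add _ (d + 1) (i + 1)]
    have h3 := hpos ((x : ℤ) - ((i + d + 1 : ℕ) : ℤ)) d
    simp only [cnt] at h3
    have h4 : ∀ k : ℕ, ((x : ℤ) - ((i + d + 1 : ℕ) : ℤ) + ((d + 1 + k : ℕ) : ℤ)) =
        (x : ℤ) - i + k := by
      intro k
      push_cast
      ring
    simp only [h4, ← heq]
    simp only [← heq] at h3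
    omega
  have hcard : (Finset.Icc 1 r ×ˢ (Finset.univ : Finset X)).card = r * Fintype.card X := by
    simp
  rw [← hcard]
  refine Finset.card_le_card_of_injOn
    (fun i : ℕ => (cnt ((x : ℤ) - i) i, s ((x : ℤ) - i))) (fun i hi => ?_) ?_
  · have hi' := (Finset.mem_filter.mp hi).2
    simp [hpos, hi']
  · intro i _ i' _ heq
    simp only [Prod.mk.injEq] at heq
    rcases lt_trichotomy i i' with hlt | hlt | hlt
    · exact absurd heq.1 (hmono i i' hlt heq.2).ne
    · exact hlt
    · exact absurd heq.1 (hmono i' i hlt heq.2.symm).ne'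

/-- `x ↦ exp (-β x²)` is strictly convex beyond its inflection point, which is at most `1` as soon
as `β ≥ 1/2`. -/
theorem strictConvexOn_gauss {β : ℝ} (hβ : 1 / 2 ≤ β) :
    StrictConvexOn ℝ (Set.Ici 1) fun x : ℝ => Real.exp (-β * x ^ 2) := by
  have hd : ∀ x : ℝ, HasDerivAt (fun x : ℝ => Real.exp (-β * x ^ 2))
      (-2 * β * x * Real.exp (-β * x ^ 2)) x := by
    intro x
    have := ((hasDerivAt_pow 2 x).const_mul (-β)).exp
    convert this using 1
    push_cast
    ring
  have hd1 : deriv (fun x : ℝ => Real.exp (-β * x ^ 2)) =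
      fun x => -2 * β * x * Real.exp (-β * x ^ 2) := funext fun x => (hd x).deriv
  have hd2 : ∀ x : ℝ, HasDerivAt (fun x : ℝ => -2 * β * x * Real.exp (-β * x ^ 2))
      (2 * β * (2 * β * x ^ 2 - 1) * Real.exp (-β * x ^ 2)) x := by
    intro x
    have := ((hasDerivAt_id x).const_mul (-2 * β)).mul (hd x)
    refine this.congr_deriv ?_
    rw [id]
    ring
  refine strictConvexOn_of_deriv2_pos (convex_Ici 1) (by fun_prop) fun x hx => ?_
  rw [interior_Ici, Set.mem_Ioi] at hx
  have e : deriv^[2] (fun x : ℝ => Real.exp (-β * x ^ 2)) x =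
      2 * β * (2 * β * x ^ 2 - 1) * Real.exp (-β * x ^ 2) := by
    rw [Function.iterate_succ, Function.iterate_one, Function.comp_apply, hd1, (hd2 x).deriv]
  rw [e]
  have h1 : 0 < 2 * β * x ^ 2 - 1 := by nlinarith
  positivity

theorem gauss_le_of_le {β x y : ℝ} (hβ : 0 < β) (hx : 0 ≤ x) (hxy : x ≤ y) :
    Real.exp (-β * y ^ 2) ≤ Real.exp (-β * x ^ 2) := by
  apply Real.exp_le_exp.mpr
  have : x ^ 2 ≤ y ^ 2 := by gcongr
  nlinarith

theorem gauss_lt_of_lt {β x y : ℝ} (hβ : 0 < β) (hx : 0 ≤ x) (hxy : x < y) :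
    Real.exp (-β * y ^ 2) < Real.exp (-β * x ^ 2) := by
  apply Real.exp_lt_exp.mpr
  have : x ^ 2 < y ^ 2 := by gcongr
  nlinarith

/-- Jensen's inequality for the `r`-th return times. -/
theorem gaussWeight_le_average_returnTime [Fintype X] {β : ℝ} (hβ : 1 / 2 ≤ β) (hP : 0 < P)
    (hs : Function.Periodic s (P : ℤ)) (r : ℕ) :
    P * gaussWeight β (Fintype.card X * r : ℕ) ≤
      ∑ h ∈ Finset.range P, gaussWeight β (returnTime s h r) := by
  rcases Nat.eq_zero_or_pos r with rfl | hr
  · simp [returnTime_zero]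
  have hP' : (0 : ℝ) < P := by exact_mod_cast hP
  have hw : ∑ _h ∈ Finset.range P, (1 / (P : ℝ)) = 1 := by
    simp [hP'.ne']
  have hmem : ∀ h ∈ Finset.range P, (returnTime s h r : ℝ) ∈ Set.Ici (1 : ℝ) := by
    intro h _
    have := le_returnTime hP hs h r
    simp only [Set.mem_Ici]
    exact_mod_cast hr.trans_le this
  have hJ := (strictConvexOn_gauss hβ).convexOn.map_sum_le (fun _ _ => by positivity) hw hmem
  simp only [smul_eq_mul, ← Finset.mul_sum] at hJ
  have hsum : (∑ h ∈ Finset.range P, (returnTime s h r : ℝ)) ≤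
      P * ((Fintype.card X * r : ℕ) : ℝ) := by
    have := sum_returnTime_le hP hs r
    rw [mul_comm r] at this
    exact_mod_cast this
  have hle : 1 / (P : ℝ) * ∑ h ∈ Finset.range P, (returnTime s h r : ℝ) ≤
      ((Fintype.card X * r : ℕ) : ℝ) := by
    rw [one_div, inv_mul_le_iff₀ hP']
    exact hsum
  have h2 := (gauss_le_of_le (by linarith) (by positivity) hle).trans hJ
  rw [one_div, le_inv_mul_iff₀ hP'] at h2
  simpa [gaussWeight] using h2

/-- Equality in Jensen's inequality for the first return times forces them all to be `|X|`. -/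
theorem returnTime_one_eq [Fintype X] {β : ℝ} (hβ : 1 / 2 ≤ β) (hP : 0 < P)
    (hs : Function.Periodic s (P : ℤ))
    (heq : ∑ h ∈ Finset.range P, gaussWeight β (returnTime s h 1) ≤
      P * gaussWeight β (Fintype.card X)) (h : ℤ) :
    returnTime s h 1 = Fintype.card X := by
  have hP' : (0 : ℝ) < P := by exact_mod_cast hP
  have hw : ∑ _h ∈ Finset.range P, (1 / (P : ℝ)) = 1 := by
    simp [hP'.ne']
  have hmem : ∀ h ∈ Finset.range P, (returnTime s h 1 : ℝ) ∈ Set.Ici (1 : ℝ) := by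
    intro h _
    have := le_returnTime hP hs h 1
    simp only [Set.mem_Ici]
    exact_mod_cast this
  have hsum : (∑ h ∈ Finset.range P, (returnTime s h 1 : ℝ)) ≤
      P * (Fintype.card X : ℝ) := by
    have := sum_returnTime_le hP hs 1
    rw [one_mul] at this
    exact_mod_cast this
  have heq' : 1 / (P : ℝ) * ∑ h ∈ Finset.range P, Real.exp (-β * (returnTime s h 1 : ℝ) ^ 2) ≤
      Real.exp (-β * (Fintype.card X : ℝ) ^ 2) := by
    rw [one_div, inv_mul_le_iff₀ hP']
    simpa [gaussWeight] using heq
  set avg := 1 / (P : ℝ) * ∑ h ∈ Finset.range P, (returnTime s h 1 : ℝ) with havg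
  have hle : avg ≤ (Fintype.card X : ℝ) := by
    rw [havg, one_div, inv_mul_le_iff₀ hP']
    exact hsum
  have hconv := strictConvexOn_gauss hβ
  have hJ := hconv.convexOn.map_sum_le (fun _ _ => by positivity) hw hmem
  have hiff := hconv.map_sum_lt_iff_of_pos' (fun _ _ => by positivity) hw hmem
  simp only [smul_eq_mul, ← Finset.mul_sum, ← havg] at hJ hiff
  have havg0 : 0 ≤ avg := by positivity
  have hβ0 : 0 < β := by linarith
  have havgeq : avg = Fintype.card X := by
    by_contra hne
    have := gauss_lt_of_lt hβ0 havg0 (lt_of_le_of_ne hle hne)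
    linarith
  have hnot : ¬ ∃ j ∈ Finset.range P, (returnTime s j 1 : ℝ) ≠ avg := by
    rw [← hiff, havgeq]
    exact not_lt.mpr heq'
  push Not at hnot
  have hall : ∀ j ∈ Finset.range P, returnTime s j 1 = Fintype.card X := by
    intro j hj
    have := hnot j hj
    rw [havgeq] at this
    exact_mod_cast this
  -- reduce `h` modulo the period
  have hmod : returnTime s h 1 = returnTime s (h % P) 1 := by
    have := (returnTime_periodic hs 1).int_mul (h / P) (h % P)
    rw [← this]
    congr 1
    rw [Int.cast_id, mul_comm]
    exact (Int.emod_add_mul_ediv h P).symm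
  have hPz : (0 : ℤ) < P := by exact_mod_cast hP
  have h0 := Int.emod_nonneg h hPz.ne'
  have hlt := Int.emod_lt_of_pos h hPz
  rw [hmod]
  lift h % (P : ℤ) to ℕ using h0 with m
  exact hall m (Finset.mem_range.mpr (by exact_mod_cast hlt))

theorem recurrence_summable {β : ℝ} (hβ : 0 < β) (s : ℤ → X) (h : ℤ) :
    Summable ({j : ℤ | s (h + j) = s h}.indicator (gaussWeight β)) :=
  (gaussWeight_summable hβ).indicator _

theorem hasSum_int_of_even {f : ℤ → ℝ} {a : ℝ} (hf : ∀ j, f (-j) = f j)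
    (h : HasSum (fun n : ℕ => f n) a) : HasSum f (2 * a - f 0) := by
  have h1 : HasSum (fun n : ℕ => f (-((n : ℤ) + 1))) (a - f 0) := by
    have := (hasSum_nat_add_iff' (f := fun n : ℕ => f n) 1).mpr h
    rw [Finset.sum_range_one, Nat.cast_zero] at this
    refine this.congr_fun fun n => ?_
    rw [hf, Nat.cast_add, Nat.cast_one]
  have := h.of_nat_of_neg_add_one h1
  convert this using 1
  ring

/-- Recurrences backwards and forwards contribute equally, and the forward ones are enumerated by
the return times. -/
theorem hasSum_returnTime {β : ℝ} (hβ : 0 < β) (hP : 0 < P)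
    (hs : Function.Periodic s (P : ℤ)) :
    HasSum (fun r : ℕ => ∑ h ∈ Finset.range P, gaussWeight β (returnTime s h r))
      ((∑ h ∈ Finset.range P, recurrenceEnergy β s h + P * gaussWeight β 0) / 2) := by
  set ind : ℤ → ℤ → ℝ := fun h => {j : ℤ | s (h + j) = s h}.indicator (gaussWeight β) with hind
  have hsummable : ∀ h, Summable (ind h) := recurrence_summable hβ s
  have hnat : ∀ h, Summable fun j : ℕ => ind h j := fun h =>
    (hsummable h).comp_injective Nat.cast_injective
  -- forward recurrences
  have hfwd : ∀ h : ℤ, HasSum (fun r : ℕ => gaussWeight β (returnTime s h r))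
      (∑' j : ℕ, ind h j) := by
    intro h
    have hinf := infinite_returns hP hs h
    have h1 := (Nat.nth_injective hinf).hasSum_iff (f := fun j : ℕ => ind h j)
      (a := ∑' j : ℕ, ind h j) (fun j hj => by
        rw [Nat.range_nth_of_infinite hinf] at hj
        exact Set.indicator_of_notMem (s := {j : ℤ | s (h + j) = s h}) hj _)
    refine HasSum.congr_fun (h1.mpr (hnat h).hasSum) fun r => ?_
    have hr : s (h + (returnTime s h r : ℕ)) = s h := Nat.nth_mem_of_infinite hinf r
    exact (Set.indicator_of_mem (s := {j : ℤ | s (h + j) = s h}) hr _).symm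
  have hU := hasSum_sum (s := Finset.range P) fun (h : ℕ) _ => hfwd h
  -- the total over a period is even in the distance
  set T : ℤ → ℝ := fun j => ∑ h ∈ Finset.range P, ind h j with hT
  have hTeven : ∀ j, T (-j) = T j := by
    intro j
    have hper : Function.Periodic (fun h => ind h j) (P : ℤ) := by
      intro h
      have : ∀ j : ℤ, s (h + P + j) = s (h + j) := by
        intro j
        rw [add_right_comm]
        exact hs _
      simp only [hind, this, hs h]
    have h1 := sum_range_add_of_periodic hper (-j)
    simp only [hT]
    rw [← h1]
    refine Finset.sum_congr rfl fun h _ => ?_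
    simp only [hind]
    by_cases hc : s (h + -j) = s h
    · rw [Set.indicator_of_mem (s := {j : ℤ | s (h + j) = s h}) hc,
        Set.indicator_of_mem (by simp [hc]), gaussWeight_neg]
    · rw [Set.indicator_of_notMem (s := {j : ℤ | s (h + j) = s h}) hc,
        Set.indicator_of_notMem (by simpa using fun h => hc h.symm)]
  have hTnat : HasSum (fun n : ℕ => T n) (∑ h ∈ Finset.range P, ∑' j : ℕ, ind h j) :=
    hasSum_sum fun (h : ℕ) _ => (hnat h).hasSum
  have hTint : HasSum T (∑ h ∈ Finset.range P, recurrenceEnergy β s h) :=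
    hasSum_sum fun (h : ℕ) _ => (hsummable h).hasSum
  have hT0 : T 0 = P * gaussWeight β 0 := by
    simp [hT, hind]
  have := hTint.unique (hasSum_int_of_even hTeven hTnat)
  rw [this, hT0]
  convert hU using 1
  ring

theorem hasSum_gaussWeight_mul {β : ℝ} (hβ : 0 < β) {N : ℕ} (hN : 0 < N) :
    HasSum (fun r : ℕ => gaussWeight β (N * r : ℕ))
      ((∑' m : ℤ, gaussWeight β (N * m) + gaussWeight β 0) / 2) := by
  have hinj : Function.Injective fun m : ℤ => (N : ℤ) * m :=
    mul_right_injective₀ (by exact_mod_cast hN.ne')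
  have hs : Summable fun m : ℤ => gaussWeight β (N * m) :=
    (gaussWeight_summable hβ).comp_injective hinj
  have h1 : Summable fun r : ℕ => gaussWeight β (N * (r : ℤ)) :=
    hs.comp_injective Nat.cast_injective
  have h2 := hasSum_int_of_even (f := fun m : ℤ => gaussWeight β (N * m))
    (fun m => by rw [mul_neg, gaussWeight_neg]) h1.hasSum
  rw [hs.hasSum.unique h2]
  convert h1.hasSum using 1
  · simp
  · simp

/-- For `β ≥ 1/2` the average recurrence energy is smallest when each of the `|X|` values recurs
exactly at the multiples of `|X|`. -/
theorem le_sum_recurrenceEnergy [Fintype X] {β : ℝ} (hβ : 1 / 2 ≤ β) (hP : 0 < P)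
    (hs : Function.Periodic s (P : ℤ)) :
    P * ∑' m : ℤ, gaussWeight β (Fintype.card X * m) ≤
      ∑ h ∈ Finset.range P, recurrenceEnergy β s h := by
  have hβ0 : 0 < β := by linarith
  have hX : 0 < Fintype.card X := Fintype.card_pos_iff.mpr ⟨s 0⟩
  have h1 := (hasSum_gaussWeight_mul hβ0 hX).mul_left (P : ℝ)
  have h2 := hasSum_le (gaussWeight_le_average_returnTime hβ hP hs) h1
    (hasSum_returnTime hβ0 hP hs)
  linarith

/-- The equality case of `le_sum_recurrenceEnergy`. -/
theorem returnTime_one_eq_of_recurrenceEnergy_le [Fintype X] {β : ℝ} (hβ : 1 / 2 ≤ β)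
    (hP : 0 < P) (hs : Function.Periodic s (P : ℤ))
    (hle : ∑ h ∈ Finset.range P, recurrenceEnergy β s h ≤
      P * ∑' m : ℤ, gaussWeight β (Fintype.card X * m)) (h : ℤ) :
    returnTime s h 1 = Fintype.card X := by
  have hβ0 : 0 < β := by linarith
  have hX : 0 < Fintype.card X := Fintype.card_pos_iff.mpr ⟨s 0⟩
  have h1 := (hasSum_gaussWeight_mul hβ0 hX).mul_left (P : ℝ)
  refine returnTime_one_eq hβ hP hs ?_ h
  by_contra hlt
  push Not at hlt
  have h2 := hasSum_lt (i := 1) (gaussWeight_le_average_returnTime hβ hP hs)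
    (by simpa using hlt) h1 (hasSum_returnTime hβ0 hP hs)
  linarith

/-- Each period of `s` contributes to the recurrence energy. -/
theorem le_recurrenceEnergy {β : ℝ} (hβ : 0 < β) (hP : 0 < P)
    (hs : Function.Periodic s (P : ℤ)) (h : ℤ) :
    ∑' m : ℤ, gaussWeight β (P * m) ≤ recurrenceEnergy β s h := by
  have hinj : Function.Injective fun m : ℤ => (P : ℤ) * m :=
    mul_right_injective₀ (by exact_mod_cast hP.ne')
  refine Summable.tsum_le_tsum_of_inj (fun m : ℤ => (P : ℤ) * m) hinj
    (fun j _ => Set.indicator_nonneg (fun j _ => (gaussWeight_pos β j).le) j) (fun m => ?_)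
    ((gaussWeight_summable hβ).comp_injective hinj) (recurrence_summable hβ s h)
  have : s (h + P * m) = s h := by
    rw [mul_comm]
    simpa using hs.int_mul m h
  exact (Set.indicator_of_mem (s := {j : ℤ | s (h + j) = s h}) this _).ge

theorem tsum_indicator_dvd (β : ℝ) {N : ℕ} (hN : 0 < N) :
    ∑' j : ℤ, {j : ℤ | (N : ℤ) ∣ j}.indicator (gaussWeight β) j =
      ∑' m : ℤ, gaussWeight β (N * m) := by
  have hinj : Function.Injective fun m : ℤ => (N : ℤ) * m :=
    mul_right_injective₀ (by exact_mod_cast hN.ne')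
  rw [← hinj.tsum_eq]
  · refine tsum_congr fun m => ?_
    exact Set.indicator_of_mem (s := {j : ℤ | (N : ℤ) ∣ j}) ⟨m, rfl⟩ _
  · intro j hj
    have : j ∈ {j : ℤ | (N : ℤ) ∣ j} := Set.support_indicator_subset hj
    obtain ⟨m, rfl⟩ := this
    exact ⟨m, rfl⟩

theorem recurrenceEnergy_eq {β : ℝ} {N : ℕ} (hN : 0 < N) {h : ℤ}
    (hs : ∀ j : ℤ, s (h + j) = s h ↔ (N : ℤ) ∣ j) :
    recurrenceEnergy β s h = ∑' m : ℤ, gaussWeight β (N * m) := by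
  unfold recurrenceEnergy
  simp only [hs]
  exact tsum_indicator_dvd β hN

theorem recurrenceEnergy_periodic (β : ℝ) (hs : Function.Periodic s (P : ℤ)) :
    Function.Periodic (recurrenceEnergy β s) (P : ℤ) := by
  intro h
  have : ∀ j : ℤ, s (h + P + j) = s (h + j) := by
    intro j
    rw [add_right_comm]
    exact hs _
  simp only [recurrenceEnergy, this, hs h]

theorem tsum_gaussWeight_mul_lt {β : ℝ} (hβ : 0 < β) {M N : ℕ} (hM : 0 < M) (hMN : M < N) :
    ∑' m : ℤ, gaussWeight β (N * m) < ∑' m : ℤ, gaussWeight β (M * m) := by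
  have hinj : ∀ {K : ℕ}, 0 < K → Function.Injective fun m : ℤ => (K : ℤ) * m := fun hK =>
    mul_right_injective₀ (by exact_mod_cast hK.ne')
  have hMN' : (M : ℝ) < N := by exact_mod_cast hMN
  refine Summable.tsum_lt_tsum (i := 1) (fun m => ?_) ?_
    ((gaussWeight_summable hβ).comp_injective (hinj (hM.trans hMN)))
    ((gaussWeight_summable hβ).comp_injective (hinj hM))
  · have h1 : ((M : ℝ) * m) ^ 2 ≤ ((N : ℝ) * m) ^ 2 := by
      rw [mul_pow, mul_pow]
      gcongr
    apply Real.exp_le_exp.mpr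
    push_cast
    nlinarith
  · simpa [gaussWeight] using gauss_lt_of_lt hβ (Nat.cast_nonneg M) hMN'

end Recurrence

section BijectiveLayering

variable {X : Type*} {H : Finset X}

theorem IsBijectiveLayering.eq_iff_dvd {b : ℤ → H} (hb : IsBijectiveLayering H b) (h j : ℤ) :
    b (h + j) = b h ↔ (H.card : ℤ) ∣ j := by
  obtain ⟨hper, -, hinj, -⟩ := hb
  have hN : 0 < (H.card : ℤ) := by exact_mod_cast Finset.card_pos.mpr ⟨_, (b 0).2⟩
  constructor
  · intro heq
    have hred : ∀ k : ℤ, b k = b ((k - 1) % H.card + 1) := by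
      intro k
      have := hper.int_mul ((k - 1) / H.card) ((k - 1) % H.card + 1)
      rw [← this]
      congr 1
      have := Int.emod_add_mul_ediv (k - 1) H.card
      rw [Int.cast_id, mul_comm]
      linarith
    have hmem : ∀ k : ℤ, (k - 1) % H.card + 1 ∈ Set.Icc 1 (H.card : ℤ) := by
      intro k
      have h0 := Int.emod_nonneg (k - 1) hN.ne'
      have h1 := Int.emod_lt_of_pos (k - 1) hN
      constructor <;> omega
    rw [hred (h + j), hred h] at heq
    have h1 := add_right_cancel (hinj (hmem _) (hmem _) heq)
    have h2 : (H.card : ℤ) ∣ (h + j - 1) - (h - 1) := Int.ModEq.dvd h1.symm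
    have e : (h + j - 1) - (h - 1) = j := by ring
    rwa [e] at h2
  · rintro ⟨m, rfl⟩
    rw [mul_comm]
    simpa using hper.int_mul m h

/-- A map whose values first recur after exactly `|H|` steps is one of the bijective layerings. -/
theorem isBijectiveLayering_of_returnTime {P : ℕ} {s : ℤ → H} (hP : 0 < P)
    (hs : Function.Periodic s (P : ℤ)) (hret : ∀ h, returnTime s h 1 = H.card) :
    IsBijectiveLayering H s := by
  have hinj : Set.InjOn s (Set.Icc 1 (H.card : ℤ)) := by
    have hlt : ∀ x ∈ Set.Icc 1 (H.card : ℤ), ∀ y ∈ Set.Icc 1 (H.card : ℤ), x < y →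
        s x ≠ s y := by
      intro x hx y hy hxy heq
      obtain ⟨d, hd⟩ := Int.eq_ofNat_of_zero_le (sub_nonneg.mpr hxy.le)
      have hinf := infinite_returns hP hs x
      have hdp : s (x + d) = s x := by
        rw [← hd, heq]
        congr 1
        ring
      have hd0 : 0 < d := by omega
      have h1 : d < Nat.nth (fun j : ℕ => s (x + j) = s x) (0 + 1) := by
        have := hret x
        unfold returnTime at this
        rw [zero_add, this]
        have := hx.1
        have := hy.2
        omega
      have h2 := Nat.le_nth_of_lt_nth_succ h1 hdp
      have h3 := returnTime_zero s x
      unfold returnTime at h3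
      omega
    intro x hx y hy heq
    rcases lt_trichotomy x y with h | h | h
    · exact absurd heq (hlt x hx y hy h)
    · exact h
    · exact absurd heq.symm (hlt y hy x hx h)
  refine ⟨fun h => ?_, fun _ _ => Set.mem_univ _, hinj, ?_⟩
  · have := Nat.nth_mem_of_infinite (infinite_returns hP hs h) 1
    have hr := hret h
    unfold returnTime at hr
    rwa [hr] at this
  · classical
    have himg : (Finset.Icc 1 (H.card : ℤ)).image s = Finset.univ := by
      apply Finset.eq_univ_of_card
      rw [Finset.card_image_of_injOn (by simpa using hinj)]
      simp
    intro x _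
    have hx : x ∈ (Finset.Icc 1 (H.card : ℤ)).image s := himg ▸ Finset.mem_univ x
    obtain ⟨k, hk, rfl⟩ := Finset.mem_image.mp hx
    exact ⟨k, by simpa using hk, rfl⟩

theorem exists_isBijectiveLayering (hH : H.Nonempty) : ∃ b : ℤ → H, IsBijectiveLayering H b := by
  have hN : 0 < (H.card : ℤ) := by exact_mod_cast Finset.card_pos.mpr hH
  have hlt : ∀ k : ℤ, ((k - 1) % H.card).toNat < H.card := by
    intro k
    have := Int.emod_nonneg (k - 1) hN.ne'
    have := Int.emod_lt_of_pos (k - 1) hN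
    omega
  refine ⟨fun k => H.equivFin.symm ⟨((k - 1) % H.card).toNat, hlt k⟩, fun k => ?_,
    fun _ _ => Set.mem_univ _, fun x hx y hy hxy => ?_, fun z _ => ?_⟩
  · have : (k + H.card - 1) % (H.card : ℤ) = (k - 1) % H.card := by
      rw [add_sub_right_comm, Int.add_emod_right]
    simp only [this]
  · have h1 := H.equivFin.symm.injective hxy
    simp only [Fin.mk.injEq] at h1
    rw [Int.emod_eq_of_lt (by linarith [hx.1]) (by linarith [hx.2]),
      Int.emod_eq_of_lt (by linarith [hy.1]) (by linarith [hy.2])] at h1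
    have := hx.1
    have := hy.1
    omega
  · have hz := (H.equivFin z).2
    refine ⟨(H.equivFin z : ℤ) + 1, ⟨by omega, by omega⟩, ?_⟩
    rw [Equiv.symm_apply_eq]
    apply Fin.ext
    simp only [add_sub_cancel_right]
    rw [Int.emod_eq_of_lt (by omega) (by omega)]
    simp

end BijectiveLayering

/-! ### The energy of a layered configuration -/

section LayerEnergy

variable {n : ℕ} {Λ₀ : Submodule ℤ (EuclideanSpace ℝ (Fin n))} {t α : ℝ}

theorem IsBravaisLattice.gaussSummable (hΛ : IsBravaisLattice Λ₀) : GaussSummable Λ₀ := by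
  obtain ⟨k, v, hv, rfl⟩ := hΛ
  have := discreteTopology_span_of_linearIndependent hv
  exact gaussSummable_of_discrete _

theorem SameSymmetries.shiftedTheta_eq {H : Finset (EuclideanSpace ℝ (Fin n))}
    (hH : SameSymmetries Λ₀ H) (α : ℝ) {x y w z : EuclideanSpace ℝ (Fin n)} (hx : x ∈ H)
    (hy : y ∈ H) (hw : w ∈ H) (hz : z ∈ H) (hxy : x ≠ y) (hwz : w ≠ z) :
    shiftedTheta Λ₀ α (x - y) = shiftedTheta Λ₀ α (w - z) := by
  obtain ⟨φ, hφ⟩ := hH x hx y hy w hw z hz hxy hwz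
  unfold shiftedTheta
  rw [← φ.tsum_eq (fun p : Λ₀ => Real.exp (-Real.pi * α * ‖(p : EuclideanSpace ℝ (Fin n)) +
    (w - z)‖ ^ 2))]
  refine tsum_congr fun p => ?_
  rw [← add_sub_assoc, ← add_sub_assoc, hφ p]

/-- The points of a layering are indexed by the layer and the lattice vector. -/
noncomputable def layeringEquiv (Λ₀ : Submodule ℤ (EuclideanSpace ℝ (Fin n))) (ht : 0 < t)
    (s : ℤ → EuclideanSpace ℝ (Fin n)) : ℤ × Λ₀ ≃ layering Λ₀ t s :=
  Equiv.ofInjective _ <| by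
    rintro ⟨k, p⟩ ⟨k', p'⟩ h
    have h2 := congrArg (fun x : Ambient n => x.snd) h
    have h1 := congrArg (fun x : Ambient n => x.fst) h
    simp only [basePoint, WithLp.add_fst, WithLp.add_snd, WithLp.toLp_fst, WithLp.toLp_snd,
      add_zero, mul_eq_mul_right_iff,
      Int.cast_inj, ht.ne', or_false] at h1 h2
    subst h2
    rw [Subtype.ext (add_left_cancel h1)]

theorem norm_layer_sub_sq (s : ℤ → EuclideanSpace ℝ (Fin n)) (k : ℤ)
    (p : EuclideanSpace ℝ (Fin n)) (x : Ambient n) :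
    ‖basePoint t s k + WithLp.toLp 2 (p, (0 : ℝ)) - x‖ ^ 2 =
      ‖p + (s k - x.fst)‖ ^ 2 + (k * t - x.snd) ^ 2 := by
  rw [WithLp.prod_norm_sq_eq_of_L2]
  simp only [basePoint, WithLp.add_fst, WithLp.add_snd, WithLp.sub_fst, WithLp.sub_snd,
    WithLp.toLp_fst, WithLp.toLp_snd, add_zero,
    Real.norm_eq_abs, sq_abs]
  congr 3
  abel

theorem summable_vertical (hα : 0 < α) (ht : 0 < t) (y : ℝ) :
    Summable fun k : ℤ => Real.exp (-Real.pi * α * (k * t - y) ^ 2) := by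
  have hβ : 0 < Real.pi * α * t ^ 2 / 2 := by positivity
  refine Summable.of_nonneg_of_le (fun _ => (Real.exp_pos _).le) (fun k => ?_)
    ((gaussWeight_summable hβ).mul_left (Real.exp (Real.pi * α * y ^ 2)))
  rw [gaussWeight, ← Real.exp_add]
  apply Real.exp_le_exp.mpr
  have : 0 < Real.pi * α := by positivity
  nlinarith [mul_nonneg this.le (sq_nonneg (k * t - 2 * y))]

/-- The Gaussian sums of a layering converge, layer by layer. -/
theorem hasSum_layering (hΛ : GaussSummable Λ₀) (ht : 0 < t) (hα : 0 < α)
    (s : ℤ → EuclideanSpace ℝ (Fin n)) (x : Ambient n) :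
    (Summable fun p : layering Λ₀ t s => Real.exp (-Real.pi * α * ‖(p : Ambient n) - x‖ ^ 2)) ∧
    HasSum (fun k : ℤ => Real.exp (-Real.pi * α * (k * t - x.snd) ^ 2) *
      shiftedTheta Λ₀ α (s k - x.fst)) (pointEnergy (layering Λ₀ t s) α x) := by
  have hterm : ∀ q : ℤ × Λ₀, Real.exp (-Real.pi * α *
      ‖((layeringEquiv Λ₀ ht s q : layering Λ₀ t s) : Ambient n) - x‖ ^ 2) =
      Real.exp (-Real.pi * α * (q.1 * t - x.snd) ^ 2) *
        Real.exp (-Real.pi * α *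
          ‖(q.2 : EuclideanSpace ℝ (Fin n)) + (s q.1 - x.fst)‖ ^ 2) := by
    intro q
    have : ((layeringEquiv Λ₀ ht s q : layering Λ₀ t s) : Ambient n) = basePoint t s q.1 +
      WithLp.toLp 2 ((q.2 : EuclideanSpace ℝ (Fin n)), (0 : ℝ)) := rfl
    rw [this, norm_layer_sub_sq, ← Real.exp_add]
    congr 1
    ring
  have hfib : ∀ k : ℤ, HasSum (fun p : Λ₀ => Real.exp (-Real.pi * α * (k * t - x.snd) ^ 2) *
      Real.exp (-Real.pi * α * ‖(p : EuclideanSpace ℝ (Fin n)) + (s k - x.fst)‖ ^ 2))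
      (Real.exp (-Real.pi * α * (k * t - x.snd) ^ 2) * shiftedTheta Λ₀ α (s k - x.fst)) :=
    fun k => (hΛ α hα (s k - x.fst)).hasSum.mul_left _
  have hsum : Summable fun q : ℤ × Λ₀ => Real.exp (-Real.pi * α * (q.1 * t - x.snd) ^ 2) *
      Real.exp (-Real.pi * α * ‖(q.2 : EuclideanSpace ℝ (Fin n)) + (s q.1 - x.fst)‖ ^ 2) := by
    rw [summable_prod_of_nonneg fun _ => by positivity]
    refine ⟨fun k => (hfib k).summable, ?_⟩
    simp only [(hfib _).tsum_eq]
    refine Summable.of_nonneg_of_le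
      (fun k => mul_nonneg (Real.exp_pos _).le (shiftedTheta_nonneg _ _ _)) (fun k => ?_)
      ((summable_vertical hα ht x.snd).mul_right (shiftedTheta Λ₀ α 0))
    exact mul_le_mul_of_nonneg_left (shiftedTheta_le hΛ hα _) (Real.exp_pos _).le
  have hsum' : Summable fun p : layering Λ₀ t s =>
      Real.exp (-Real.pi * α * ‖(p : Ambient n) - x‖ ^ 2) := by
    rw [← (layeringEquiv Λ₀ ht s).summable_iff]
    exact hsum.congr fun q => (hterm q).symm
  refine ⟨hsum', ?_⟩
  have h1 := hsum'.hasSum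
  rw [← (layeringEquiv Λ₀ ht s).hasSum_iff] at h1
  exact (h1.congr_fun fun q => (hterm q).symm).prod_fiberwise hfib

/-- The energy of a layer, summed over the vertical distance `j` to the other layers. -/
theorem hasSum_layer (hΛ : GaussSummable Λ₀) (ht : 0 < t) (hα : 0 < α)
    (s : ℤ → EuclideanSpace ℝ (Fin n)) (h : ℤ) :
    HasSum (fun j : ℤ => gaussWeight (Real.pi * α * t ^ 2) j *
      shiftedTheta Λ₀ α (s (h + j) - s h))
      (pointEnergy (layering Λ₀ t s) α (basePoint t s h)) := by
  have h1 := (hasSum_layering hΛ ht hα s (basePoint t s h)).2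
  rw [← (Equiv.addLeft h).hasSum_iff] at h1
  refine h1.congr_fun fun j => ?_
  simp only [gaussWeight, basePoint, WithLp.toLp_fst, WithLp.toLp_snd, Function.comp_apply,
    Equiv.coe_addLeft]
  congr 2
  push_cast
  ring

/-- The energy of a layer when every other layer contributes one of only two values. -/
theorem pointEnergy_eq_of_two_values (hΛ : GaussSummable Λ₀) (ht : 0 < t) (hα : 0 < α)
    (s : ℤ → EuclideanSpace ℝ (Fin n)) (h : ℤ) (S : Set ℤ) {A B : ℝ}
    (hA : ∀ j ∈ S, shiftedTheta Λ₀ α (s (h + j) - s h) = A)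
    (hB : ∀ j ∉ S, shiftedTheta Λ₀ α (s (h + j) - s h) = B) :
    pointEnergy (layering Λ₀ t s) α (basePoint t s h) =
      B * ∑' j : ℤ, gaussWeight (Real.pi * α * t ^ 2) j +
        (A - B) * ∑' j : ℤ, S.indicator (gaussWeight (Real.pi * α * t ^ 2)) j := by
  have hβ : 0 < Real.pi * α * t ^ 2 := by positivity
  have hg := gaussWeight_summable hβ
  refine (hasSum_layer hΛ ht hα s h).unique ?_
  refine ((hg.hasSum.mul_left B).add ((hg.indicator S).hasSum.mul_left (A - B))).congr_fun
    fun j => ?_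
  by_cases hj : j ∈ S
  · rw [hA j hj, Set.indicator_of_mem hj]
    ring
  · rw [hB j hj, Set.indicator_of_notMem hj]
    ring

/-- The average energy is an increasing affine function of the average recurrence energy. -/
theorem layeredTheta_eq_recurrence (hΛ : GaussSummable Λ₀) (ht : 0 < t) (hα : 0 < α)
    {H : Finset (EuclideanSpace ℝ (Fin n))} {B : ℝ}
    (hB : ∀ x ∈ H, ∀ y ∈ H, x ≠ y → shiftedTheta Λ₀ α (x - y) = B) {s : ℤ → H} {P : ℕ}
    (hP : 0 < P) (hs : Function.Periodic s (P : ℤ)) :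
    layeredTheta Λ₀ t α (fun k => (s k : EuclideanSpace ℝ (Fin n))) =
      B * ∑' j : ℤ, gaussWeight (Real.pi * α * t ^ 2) j + (shiftedTheta Λ₀ α 0 - B) *
        (1 / P * ∑ h ∈ Finset.range P, recurrenceEnergy (Real.pi * α * t ^ 2) s h) := by
  have hs' : Function.Periodic (fun k => (s k : EuclideanSpace ℝ (Fin n))) (P : ℤ) :=
    fun k => congrArg Subtype.val (hs k)
  have hP' : (P : ℝ) ≠ 0 := by exact_mod_cast hP.ne'
  have hpt : ∀ h : ℤ, pointEnergy (layering Λ₀ t fun k => (s k : EuclideanSpace ℝ (Fin n))) α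
      (basePoint t (fun k => (s k : EuclideanSpace ℝ (Fin n))) h) =
      B * ∑' j : ℤ, gaussWeight (Real.pi * α * t ^ 2) j + (shiftedTheta Λ₀ α 0 - B) *
        recurrenceEnergy (Real.pi * α * t ^ 2) s h := by
    intro h
    refine pointEnergy_eq_of_two_values hΛ ht hα _ h {j : ℤ | s (h + j) = s h}
      (fun j hj => ?_) (fun j hj => ?_)
    · have hj' : s (h + j) = s h := hj
      rw [hj', sub_self]
    · have hj' : ¬ s (h + j) = s h := hj
      exact hB _ (s _).2 _ (s _).2 fun heq => hj' (Subtype.ext heq)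
  rw [layeredTheta_eq Λ₀ t α _ P hP hs', averageTheta]
  simp only [hpt]
  rw [Finset.sum_add_distrib, ← Finset.mul_sum, ← Finset.mul_sum,
    sum_range_add_of_periodic (recurrenceEnergy_periodic (Real.pi * α * t ^ 2) hs) 1]
  simp only [Finset.sum_const, Finset.card_range, nsmul_eq_mul]
  field_simp

theorem layeredTheta_bijective (hΛ : GaussSummable Λ₀) (ht : 0 < t) (hα : 0 < α)
    {H : Finset (EuclideanSpace ℝ (Fin n))} {B : ℝ}
    (hB : ∀ x ∈ H, ∀ y ∈ H, x ≠ y → shiftedTheta Λ₀ α (x - y) = B) {b : ℤ → H}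
    (hb : IsBijectiveLayering H b) :
    layeredTheta Λ₀ t α (fun k => (b k : EuclideanSpace ℝ (Fin n))) =
      B * ∑' j : ℤ, gaussWeight (Real.pi * α * t ^ 2) j + (shiftedTheta Λ₀ α 0 - B) *
        ∑' m : ℤ, gaussWeight (Real.pi * α * t ^ 2) (H.card * m) := by
  have hN : 0 < H.card := Finset.card_pos.mpr ⟨_, (b 0).2⟩
  have hN' : (H.card : ℝ) ≠ 0 := by exact_mod_cast hN.ne'
  rw [layeredTheta_eq_recurrence hΛ ht hα hB hN hb.1]
  simp only [recurrenceEnergy_eq hN (hb.eq_iff_dvd _), Finset.sum_const, Finset.card_range,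
    nsmul_eq_mul]
  field_simp

/-- The common value `B` of the interaction of two layers with different shifts. It equals the
interaction of two layers with equal shifts only if all shifts agree modulo `Λ₀`. -/
theorem exists_interaction (hΛ : GaussSummable Λ₀) (hα : 0 < α)
    {H : Finset (EuclideanSpace ℝ (Fin n))} (hH : SameSymmetries Λ₀ H) :
    ∃ B ≤ shiftedTheta Λ₀ α 0,
      (∀ x ∈ H, ∀ y ∈ H, x ≠ y → shiftedTheta Λ₀ α (x - y) = B) ∧
      (B = shiftedTheta Λ₀ α 0 → ∀ x ∈ H, ∀ y ∈ H, x - y ∈ Λ₀) := by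
  by_cases hne : ∃ x ∈ H, ∃ y ∈ H, x ≠ y
  · obtain ⟨x, hx, y, hy, hxy⟩ := hne
    have hall : ∀ w ∈ H, ∀ z ∈ H, w ≠ z →
        shiftedTheta Λ₀ α (w - z) = shiftedTheta Λ₀ α (x - y) :=
      fun w hw z hz hwz => hH.shiftedTheta_eq α hw hz hx hy hwz hxy
    refine ⟨_, shiftedTheta_le hΛ hα (x - y), hall, fun heq w hw z hz => ?_⟩
    by_contra hmem
    have hwz : w ≠ z := by
      rintro rfl
      exact hmem (by simp)
    have := shiftedTheta_lt hΛ hα hmem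
    rw [hall w hw z hz hwz, heq] at this
    exact lt_irrefl _ this
  · push Not at hne
    refine ⟨0, shiftedTheta_nonneg _ _ _, fun x hx y hy hxy => absurd (hne x hx y hy) hxy,
      fun _ x hx y hy => ?_⟩
    rw [hne x hx y hy, sub_self]
    exact Λ₀.zero_mem

theorem layering_subset {s s' : ℤ → EuclideanSpace ℝ (Fin n)} (h : ∀ k, s k - s' k ∈ Λ₀) :
    layering Λ₀ t s ⊆ layering Λ₀ t s' := by
  rintro _ ⟨⟨k, p⟩, rfl⟩
  refine ⟨(k, p + ⟨s k - s' k, h k⟩), ?_⟩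
  simp only [basePoint, Submodule.coe_add, ← WithLp.toLp_add, Prod.mk_add_mk, add_zero]
  congr 2
  abel

theorem isBijectiveLayering_minimizes_periodic (hΛ : GaussSummable Λ₀) (ht : 0 < t) (hα : 0 < α)
    {H : Finset (EuclideanSpace ℝ (Fin n))} (hH : SameSymmetries Λ₀ H)
    (hβ : 1 / 2 ≤ Real.pi * α * t ^ 2) {b : ℤ → H} (hb : IsBijectiveLayering H b) :
    MinimizesTheta Λ₀ t α {s : ℤ → H | IsPeriodic s} b := by
  have hN : 0 < H.card := Finset.card_pos.mpr ⟨_, (b 0).2⟩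
  obtain ⟨B, hBA, hB, -⟩ := exists_interaction hΛ hα hH
  refine ⟨⟨H.card, hN, hb.1⟩, fun s hs => ?_⟩
  obtain ⟨P, hP, hsP⟩ := hs
  have hP' : (0 : ℝ) < P := by exact_mod_cast hP
  rw [layeredTheta_bijective hΛ ht hα hB hb, layeredTheta_eq_recurrence hΛ ht hα hB hP hsP]
  have h1 := le_sum_recurrenceEnergy hβ hP hsP
  rw [Fintype.card_coe, ← le_inv_mul_iff₀ hP', ← one_div] at h1
  have h2 : 0 ≤ shiftedTheta Λ₀ α 0 - B := sub_nonneg.mpr hBA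
  gcongr

/-- A minimizer among the periodic maps is bijective if `A > B`. If `A = B`, then all layerings are
the same set, and incongruence of `H` modulo `Λ₀` leaves only one map `ℤ → H`. -/
theorem minimizer_periodic_unique (hΛ : GaussSummable Λ₀) (ht : 0 < t) (hα : 0 < α)
    {H : Finset (EuclideanSpace ℝ (Fin n))} (hH : SameSymmetries Λ₀ H)
    (hβ : 1 / 2 ≤ Real.pi * α * t ^ 2) {s : ℤ → H}
    (hs : MinimizesTheta Λ₀ t α {s : ℤ → H | IsPeriodic s} s) :
    (∃ b : ℤ → H, IsBijectiveLayering H b ∧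
      layering Λ₀ t (fun k => (s k : EuclideanSpace ℝ (Fin n))) =
        layering Λ₀ t (fun k => (b k : EuclideanSpace ℝ (Fin n)))) ∧
    ((∀ x ∈ H, ∀ y ∈ H, x - y ∈ Λ₀ → x = y) → IsBijectiveLayering H s) := by
  have hne : H.Nonempty := ⟨_, (s 0).2⟩
  have hN : 0 < H.card := Finset.card_pos.mpr hne
  obtain ⟨B, hBA, hB, hdeg⟩ := exists_interaction hΛ hα hH
  obtain ⟨b, hb⟩ := exists_isBijectiveLayering hne
  obtain ⟨⟨P, hP, hsP⟩, hmin⟩ := hs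
  have hP' : (0 : ℝ) < P := by exact_mod_cast hP
  rcases hBA.lt_or_eq with hlt | heq
  · have hle := hmin b ⟨H.card, hN, hb.1⟩
    rw [layeredTheta_bijective hΛ ht hα hB hb,
      layeredTheta_eq_recurrence hΛ ht hα hB hP hsP, add_le_add_iff_left,
      mul_le_mul_iff_right₀ (sub_pos.mpr hlt), one_div, inv_mul_le_iff₀ hP'] at hle
    have hbs : IsBijectiveLayering H s := by
      refine isBijectiveLayering_of_returnTime hP hsP fun h => ?_
      have := returnTime_one_eq_of_recurrenceEnergy_le hβ hP hsP
        (by rw [Fintype.card_coe]; exact hle) h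
      rwa [Fintype.card_coe] at this
    exact ⟨⟨s, hbs, rfl⟩, fun _ => hbs⟩
  · -- all shifts agree modulo `Λ₀`, so all layerings coincide
    have hmem := hdeg heq
    refine ⟨⟨b, hb, Set.Subset.antisymm
      (layering_subset fun k => hmem _ (s k).2 _ (b k).2)
      (layering_subset fun k => hmem _ (b k).2 _ (s k).2)⟩, fun hinc => ?_⟩
    have : s = b := funext fun k => Subtype.ext
      (hinc _ (s k).2 _ (b k).2 (hmem _ (s k).2 _ (b k).2))
    rwa [this]

theorem isBijectiveLayering_minimizes_short (hΛ : GaussSummable Λ₀) (ht : 0 < t) (hα : 0 < α)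
    {H : Finset (EuclideanSpace ℝ (Fin n))} (hH : SameSymmetries Λ₀ H) {b : ℤ → H}
    (hb : IsBijectiveLayering H b) :
    MinimizesTheta Λ₀ t α
      {s : ℤ → H | ∃ k' : ℕ, 1 ≤ k' ∧ k' ≤ H.card ∧ Function.Periodic s (k' : ℤ)} b := by
  have hN : 0 < H.card := Finset.card_pos.mpr ⟨_, (b 0).2⟩
  have hβ : 0 < Real.pi * α * t ^ 2 := by positivity
  obtain ⟨B, hBA, hB, -⟩ := exists_interaction hΛ hα hH
  refine ⟨⟨H.card, hN, le_rfl, hb.1⟩, fun s hs => ?_⟩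
  obtain ⟨P, hP, hPN, hsP⟩ := hs
  have hP' : (0 : ℝ) < P := by exact_mod_cast hP
  rw [layeredTheta_bijective hΛ ht hα hB hb, layeredTheta_eq_recurrence hΛ ht hα hB hP hsP]
  have h1 : ∑' m : ℤ, gaussWeight (Real.pi * α * t ^ 2) (H.card * m) ≤
      ∑' m : ℤ, gaussWeight (Real.pi * α * t ^ 2) (P * m) := by
    rcases hPN.eq_or_lt with heq | hlt
    · rw [heq]
    · exact (tsum_gaussWeight_mul_lt hβ hP hlt).le
  have h2 : P * ∑' m : ℤ, gaussWeight (Real.pi * α * t ^ 2) (P * m) ≤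
      ∑ h ∈ Finset.range P, recurrenceEnergy (Real.pi * α * t ^ 2) s h := by
    have := Finset.card_nsmul_le_sum (Finset.range P)
      (fun h : ℕ => recurrenceEnergy (Real.pi * α * t ^ 2) s h) _
      fun h _ => le_recurrenceEnergy hβ hP hsP h
    simpa using this
  rw [← le_inv_mul_iff₀ hP', ← one_div] at h2
  have h3 : 0 ≤ shiftedTheta Λ₀ α 0 - B := sub_nonneg.mpr hBA
  have h4 := h1.trans h2
  gcongr

end LayerEnergy

/-! ### The face-centred cubic lattice and the hexagonal close packing -/

section FaceCentredCubic

/-- The shift `ℓ (1/2, 1/(2√3))` of the odd layers of the hexagonal close packing, a deep hole of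
the triangular lattice. -/
noncomputable def holeShift (ℓ : ℝ) : EuclideanSpace ℝ (Fin 2) := ℓ • !₂[1 / 2, 1 / (2 * √3)]

theorem sqrt_three_sq : √3 ^ 2 = (3 : ℝ) := Real.sq_sqrt (by norm_num)

theorem triangular_isBravaisLattice {ℓ : ℝ} (hℓ : 0 < ℓ) : IsBravaisLattice (triangular ℓ) := by
  refine ⟨2, ![ℓ • !₂[1, 0], ℓ • !₂[1 / 2, √3 / 2]], ?_, ?_⟩
  · rw [LinearIndependent.pair_iff]
    intro a b hab
    have h0 := congrArg (fun x : EuclideanSpace ℝ (Fin 2) => x 0) hab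
    have h1 := congrArg (fun x : EuclideanSpace ℝ (Fin 2) => x 1) hab
    simp at h0 h1
    have hb : b = 0 := by
      rcases h1 with h1 | h1
      · exact h1
      · exact absurd h1 hℓ.ne'
    subst hb
    simp at h0
    refine ⟨?_, rfl⟩
    rcases h0 with h0 | h0
    · exact h0
    · exact absurd h0 hℓ.ne'
  · rw [Matrix.range_cons, Matrix.range_cons, Matrix.range_empty, Set.union_empty]
    rfl

/-- The lattice coordinates of the triangular lattice. -/
noncomputable def triangularEquiv {ℓ : ℝ} (hℓ : 0 < ℓ) : ℤ × ℤ ≃ triangular ℓ :=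
  Equiv.ofBijective
    (fun m => ⟨m.1 • (ℓ • !₂[1, 0]) + m.2 • (ℓ • !₂[1 / 2, √3 / 2]),
      Submodule.mem_span_pair.mpr ⟨m.1, m.2, rfl⟩⟩) <| by
    constructor
    · rintro ⟨a, b⟩ ⟨a', b'⟩ h
      have h' := congrArg Subtype.val h
      have h0 := congrArg (fun x : EuclideanSpace ℝ (Fin 2) => x 0) h'
      have h1 := congrArg (fun x : EuclideanSpace ℝ (Fin 2) => x 1) h'
      simp [hℓ.ne'] at h0 h1
      subst h1
      simp [hℓ.ne'] at h0
      rw [h0]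
    · rintro ⟨x, hx⟩
      obtain ⟨a, b, hab⟩ := Submodule.mem_span_pair.mp hx
      exact ⟨(a, b), Subtype.ext hab⟩

theorem holeShift_notMem {ℓ : ℝ} (hℓ : 0 < ℓ) : holeShift ℓ ∉ triangular ℓ := by
  intro h
  obtain ⟨a, b, hab⟩ := Submodule.mem_span_pair.mp h
  have h1 := congrArg (fun x : EuclideanSpace ℝ (Fin 2) => x 1) hab
  have h3 : (0 : ℝ) < √3 := by positivity
  simp [holeShift] at h1
  field_simp at h1
  rw [sqrt_three_sq] at h1
  have : b * 3 = 1 := by exact_mod_cast h1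
  omega

theorem three_smul_holeShift_mem (ℓ : ℝ) : (3 : ℤ) • holeShift ℓ ∈ triangular ℓ := by
  refine Submodule.mem_span_pair.mpr ⟨1, 1, ?_⟩
  have h3 : (0 : ℝ) < √3 := by positivity
  ext i
  fin_cases i
  · simp [holeShift]
    ring
  · simp [holeShift]
    field_simp
    rw [sqrt_three_sq]

theorem shiftedTheta_smul_holeShift_of_dvd {ℓ α : ℝ} {j : ℤ} (hj : 3 ∣ j) :
    shiftedTheta (triangular ℓ) α (j • holeShift ℓ) = shiftedTheta (triangular ℓ) α 0 := by
  obtain ⟨m, rfl⟩ := hj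
  have : m • (3 : ℤ) • holeShift ℓ ∈ triangular ℓ :=
    (triangular ℓ).smul_mem m (three_smul_holeShift_mem ℓ)
  rw [← shiftedTheta_add_mem 0 this, zero_add, smul_smul, mul_comm]

theorem shiftedTheta_smul_holeShift_of_not_dvd {ℓ α : ℝ} {j : ℤ} (hj : ¬ 3 ∣ j) :
    shiftedTheta (triangular ℓ) α (j • holeShift ℓ) =
      shiftedTheta (triangular ℓ) α (holeShift ℓ) := by
  have hmem : ∀ m : ℤ, m • (3 : ℤ) • holeShift ℓ ∈ triangular ℓ := fun m =>
    (triangular ℓ).smul_mem m (three_smul_holeShift_mem ℓ)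
  have hcases : (∃ m, j = 1 + m * 3) ∨ ∃ m, j = -1 + m * 3 := by
    have : j % 3 = 1 ∨ j % 3 = 2 := by omega
    rcases this with h | h
    · exact Or.inl ⟨j / 3, by omega⟩
    · exact Or.inr ⟨j / 3 + 1, by omega⟩
  rcases hcases with ⟨m, rfl⟩ | ⟨m, rfl⟩
  · rw [add_smul, one_smul, mul_smul, shiftedTheta_add_mem _ (hmem m)]
  · rw [add_smul, neg_one_smul, mul_smul, shiftedTheta_add_mem _ (hmem m), shiftedTheta_neg]

/-- Points of the face-centred cubic lattice, arranged in layers `k` orthogonal to `(1, 1, 1)`. -/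
noncomputable def fccPoint (c : ℝ) (q : ℤ × ℤ × ℤ) : EuclideanSpace ℝ (Fin 3) :=
  c • !₂[(-(q.2.1 : ℝ) - q.2.2) / 2, ((q.1 : ℝ) + q.2.1) / 2, ((q.1 : ℝ) + q.2.2) / 2]

theorem fccPoint_injective {c : ℝ} (hc : 0 < c) : Function.Injective (fccPoint c) := by
  rintro ⟨k, m, n⟩ ⟨k', m', n'⟩ h
  have h0 := congrArg (fun x : EuclideanSpace ℝ (Fin 3) => x 0) h
  have h1 := congrArg (fun x : EuclideanSpace ℝ (Fin 3) => x 1) h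
  have h2 := congrArg (fun x : EuclideanSpace ℝ (Fin 3) => x 2) h
  simp [fccPoint, hc.ne'] at h0 h1 h2
  have e0 : -(m : ℝ) - n = -m' - n' := by linarith
  have e1 : (k : ℝ) + m = k' + m' := by linarith
  have e2 : (k : ℝ) + n = k' + n' := by linarith
  norm_cast at e0 e1 e2
  simp only [Prod.mk.injEq]
  omega

/-- The face-centred cubic lattice consists of the halves of integer vectors with even
coordinate sum. -/
theorem mem_fcc_iff (x : EuclideanSpace ℝ (Fin 3)) :
    x ∈ fcc ↔ ∃ a b c : ℤ, x = !₂[(a : ℝ) / 2, (b : ℝ) / 2, (c : ℝ) / 2] ∧ Even (a + b + c) := by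
  constructor
  · rintro ⟨τ, hτ, h⟩
    obtain ⟨a, ha⟩ := h 0
    obtain ⟨b, hb⟩ := h 1
    obtain ⟨c, hc⟩ := h 2
    simp only [Set.mem_insert_iff, Set.mem_singleton_iff] at hτ
    rcases hτ with rfl | rfl | rfl | rfl <;> simp at ha hb hc
    · refine ⟨2 * a, 2 * b, 2 * c, ?_, ⟨a + b + c, by ring⟩⟩
      ext i
      fin_cases i <;> simp <;> linarith
    · refine ⟨2 * a + 1, 2 * b + 1, 2 * c, ?_, ⟨a + b + c + 1, by ring⟩⟩
      ext i
      fin_cases i <;> simp <;> linarith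
    · refine ⟨2 * a + 1, 2 * b, 2 * c + 1, ?_, ⟨a + b + c + 1, by ring⟩⟩
      ext i
      fin_cases i <;> simp <;> linarith
    · refine ⟨2 * a, 2 * b + 1, 2 * c + 1, ?_, ⟨a + b + c + 1, by ring⟩⟩
      ext i
      fin_cases i <;> simp <;> linarith
  · rintro ⟨a, b, c, rfl, hev⟩
    rcases Int.even_or_odd' a with ⟨a, rfl | rfl⟩ <;>
      rcases Int.even_or_odd' b with ⟨b, rfl | rfl⟩ <;>
      rcases Int.even_or_odd' c with ⟨c, rfl | rfl⟩
    all_goals first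
      | (exfalso; rw [Int.even_iff] at hev; omega)
      | skip
    · refine ⟨_, Or.inl rfl, fun i => ⟨![a, b, c] i, ?_⟩⟩
      fin_cases i <;> simp
    · refine ⟨_, Or.inr (Or.inr (Or.inr rfl)), fun i => ⟨![a, b, c] i, ?_⟩⟩
      fin_cases i <;> simp <;> ring
    · refine ⟨_, Or.inr (Or.inr (Or.inl rfl)), fun i => ⟨![a, b, c] i, ?_⟩⟩
      fin_cases i <;> simp <;> ring
    · refine ⟨_, Or.inr (Or.inl rfl), fun i => ⟨![a, b, c] i, ?_⟩⟩
      fin_cases i <;> simp <;> ring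

theorem range_fccPoint (c : ℝ) : Set.range (fccPoint c) = scaledFcc c := by
  ext x
  constructor
  · rintro ⟨⟨k, m, n⟩, rfl⟩
    refine ⟨_, (mem_fcc_iff _).mpr ⟨-m - n, k + m, k + n, rfl, ⟨k, by ring⟩⟩, ?_⟩
    simp [fccPoint]
  · rintro ⟨y, hy, rfl⟩
    obtain ⟨a, b, d, rfl, ⟨k, hk⟩⟩ := (mem_fcc_iff _).mp hy
    refine ⟨(k, b - k, d - k), ?_⟩
    have ha : (a : ℝ) = 2 * k - b - d := by
      have : a = 2 * k - b - d := by linarith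
      exact_mod_cast this
    simp only [fccPoint, ha]
    push_cast
    congr 2
    ext i
    fin_cases i <;> simp
    ring

/-- The layers of the face-centred cubic lattice are triangular lattices shifted by multiples of
a deep hole. -/
theorem norm_fccPoint_sq {c t ℓ : ℝ} (hc : c ^ 2 = 3 * t ^ 2) (hℓ : 2 * ℓ ^ 2 = 3 * t ^ 2)
    (k m n : ℤ) :
    ‖fccPoint c (k, m, n)‖ ^ 2 =
      ‖m • (ℓ • !₂[1, 0]) + n • (ℓ • !₂[1 / 2, √3 / 2]) + k • holeShift ℓ‖ ^ 2 +
        ((k : ℝ) * t) ^ 2 := by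
  have h3 : (0 : ℝ) < √3 := by positivity
  have hs := sqrt_three_sq
  have hinv : (√3)⁻¹ = √3 / 3 := by
    rw [inv_eq_one_div, div_eq_div_iff h3.ne' three_ne_zero]
    linarith
  rw [EuclideanSpace.norm_sq_eq, EuclideanSpace.norm_sq_eq]
  simp only [fccPoint, holeShift, Fin.sum_univ_three, Fin.sum_univ_two, Real.norm_eq_abs, sq_abs]
  simp [hinv]
  have hc' : c ^ 2 = 2 * ℓ ^ 2 := by linarith
  linear_combination (((m : ℝ) + n) ^ 2 + (k + m) ^ 2 + (k + n) ^ 2) / 4 * hc' -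
    ℓ ^ 2 * ((n : ℝ) / 2 + k / 6) ^ 2 * hs + (k : ℝ) ^ 2 / 3 * hℓ

theorem theta_scaledFcc_eq {α c t ℓ : ℝ} (hc : 0 < c) (ht : 0 < t) (hℓ : 0 < ℓ)
    (hct : c ^ 2 = 3 * t ^ 2) (hℓt : 2 * ℓ ^ 2 = 3 * t ^ 2) :
    theta (scaledFcc c) α =
      pointEnergy (layering (triangular ℓ) t fun k => k • holeShift ℓ) α
        (basePoint t (fun k => k • holeShift ℓ) 0) := by
  unfold theta pointEnergy
  rw [← range_fccPoint, ← (Equiv.ofInjective _ (fccPoint_injective hc)).tsum_eq,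
    ← (((Equiv.refl ℤ).prodCongr (triangularEquiv hℓ)).trans (layeringEquiv (triangular ℓ) ht
      fun k => k • holeShift ℓ)).tsum_eq]
  refine tsum_congr fun ⟨k, m, n⟩ => ?_
  have h1 : ((((Equiv.refl ℤ).prodCongr (triangularEquiv hℓ)).trans (layeringEquiv (triangular ℓ) ht
      fun k => k • holeShift ℓ)) (k, m, n) : Ambient 2) =
      basePoint t (fun k => k • holeShift ℓ) k +
      WithLp.toLp 2 (m • (ℓ • !₂[1, 0]) + n • (ℓ • !₂[1 / 2, √3 / 2]), (0 : ℝ)) := rfl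
  rw [h1, norm_layer_sub_sq, Equiv.ofInjective_apply, sub_zero, norm_fccPoint_sq hct hℓt]
  simp [basePoint]

theorem hcpShift_sub (ℓ : ℝ) (h j : ℤ) :
    hcpShift ℓ (h + j) - hcpShift ℓ h =
      if 2 ∣ j then 0 else if Even h then holeShift ℓ else -holeShift ℓ := by
  simp only [hcpShift, Int.even_add, ← even_iff_two_dvd, ← holeShift.eq_1]
  by_cases hh : Even h <;> by_cases hj : Even j <;> simp [hh, hj]

theorem theta_fcc_lt_hcp {α c t ℓ : ℝ} (hα : 0 < α) (hc : 0 < c) (ht : 0 < t) (hℓ : 0 < ℓ)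
    (hratio : ℓ / t = √3 / √2) (hdens : c ^ 3 / 4 = √3 / 2 * t * ℓ ^ 2) :
    theta (scaledFcc c) α < layeredTheta (triangular ℓ) t α (hcpShift ℓ) := by
  have h3 : (0 : ℝ) < √3 := by positivity
  have h2 : (0 : ℝ) < √2 := by positivity
  have hs2 : √2 ^ 2 = (2 : ℝ) := Real.sq_sqrt (by norm_num)
  have hℓt : 2 * ℓ ^ 2 = 3 * t ^ 2 := by
    rw [div_eq_div_iff ht.ne' h2.ne'] at hratio
    have := congrArg (· ^ 2) hratio
    simp only [mul_pow, hs2, sqrt_three_sq] at this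
    linarith
  have hct : c ^ 2 = 3 * t ^ 2 := by
    -- the density condition reads `c³ = (√3 t)³`
    have hcube : c ^ 3 = (√3 * t) ^ 3 := by
      have e : (√3 * t) ^ 3 = √3 * √3 ^ 2 * t ^ 3 := by ring
      rw [e, sqrt_three_sq]
      linear_combination 4 * hdens + √3 * t * hℓt
    have := (pow_left_inj₀ hc.le (by positivity) three_ne_zero).mp hcube
    rw [this, mul_pow, sqrt_three_sq]
  have hΛ := (triangular_isBravaisLattice hℓ).gaussSummable
  have hβ : 0 < Real.pi * α * t ^ 2 := by positivity
  have hper : Function.Periodic (hcpShift ℓ) ((2 : ℕ) : ℤ) := by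
    intro k
    simp [hcpShift]
  have hhcp : ∀ h : ℤ, pointEnergy (layering (triangular ℓ) t (hcpShift ℓ)) α
      (basePoint t (hcpShift ℓ) h) =
      shiftedTheta (triangular ℓ) α (holeShift ℓ) *
        ∑' j : ℤ, gaussWeight (Real.pi * α * t ^ 2) j +
        (shiftedTheta (triangular ℓ) α 0 - shiftedTheta (triangular ℓ) α (holeShift ℓ)) *
          ∑' m : ℤ, gaussWeight (Real.pi * α * t ^ 2) ((2 : ℕ) * m) := by
    intro h
    rw [← tsum_indicator_dvd _ two_pos]
    refine pointEnergy_eq_of_two_values hΛ ht hα _ h _ (fun j hj => ?_) (fun j hj => ?_)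
    · have hj' : 2 ∣ j := hj
      rw [hcpShift_sub, if_pos hj']
    · have hj' : ¬ 2 ∣ j := hj
      rw [hcpShift_sub, if_neg hj']
      split_ifs
      · rfl
      · exact shiftedTheta_neg _
  have hfcc := pointEnergy_eq_of_two_values hΛ ht hα (fun k : ℤ => k • holeShift ℓ) 0
    {j : ℤ | ((3 : ℕ) : ℤ) ∣ j} (A := shiftedTheta (triangular ℓ) α 0)
    (B := shiftedTheta (triangular ℓ) α (holeShift ℓ))
    (fun j hj => by
      simpa using shiftedTheta_smul_holeShift_of_dvd (ℓ := ℓ) (α := α) hj)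
    (fun j hj => by
      simpa using shiftedTheta_smul_holeShift_of_not_dvd (ℓ := ℓ) (α := α) hj)
  rw [tsum_indicator_dvd _ three_pos] at hfcc
  rw [theta_scaledFcc_eq hc ht hℓ hct hℓt, hfcc, layeredTheta_eq _ t α _ 2 two_pos hper,
    averageTheta]
  simp only [hhcp, Finset.sum_const, Finset.card_range, nsmul_eq_mul]
  rw [← mul_assoc]
  have e : (1 / ((2 : ℕ) : ℝ)) * ((2 : ℕ) : ℝ) = 1 := by norm_num
  rw [e, one_mul]
  have hlt := shiftedTheta_lt hΛ hα (holeShift_notMem hℓ)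
  have hsum := tsum_gaussWeight_mul_lt hβ two_pos (by norm_num : 2 < 3)
  have := mul_lt_mul_of_pos_left hsum (sub_pos.mpr hlt)
  linarith

end FaceCentredCubic

end LayeredTheta

open LayeredTheta in
theorem theorem1p1 :
    (∀ (n : ℕ) (Λ₀ : Submodule ℤ (EuclideanSpace ℝ (Fin n)))
        (H : Finset (EuclideanSpace ℝ (Fin n))) (t α : ℝ),
      IsBravaisLattice Λ₀ → SameSymmetries Λ₀ H → 0 < t → 0 < α →
      -- the Gaussian sums converge
      (∀ s : ℤ → H, ∀ x : Ambient n,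
        Summable fun p : layering Λ₀ t (fun k => (s k : EuclideanSpace ℝ (Fin n))) =>
          Real.exp (-Real.pi * α * ‖(p : Ambient n) - x‖ ^ 2)) ∧
      -- optimality among all periodic maps
      (1 / (2 * Real.pi * t ^ 2) ≤ α →
        ∀ b : ℤ → H, IsBijectiveLayering H b →
          MinimizesTheta Λ₀ t α {s : ℤ → H | IsPeriodic s} b) ∧
      -- uniqueness: of the layering always, and of the map if `H` is incongruent modulo `Λ₀`
      (1 / (2 * Real.pi * t ^ 2) < α →
        ∀ s : ℤ → H, MinimizesTheta Λ₀ t α {s : ℤ → H | IsPeriodic s} s →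
          (∃ b : ℤ → H, IsBijectiveLayering H b ∧
            layering Λ₀ t (fun k => (s k : EuclideanSpace ℝ (Fin n))) =
              layering Λ₀ t (fun k => (b k : EuclideanSpace ℝ (Fin n)))) ∧
          ((∀ x ∈ H, ∀ y ∈ H, x - y ∈ Λ₀ → x = y) → IsBijectiveLayering H s)) ∧
      -- optimality among maps of period at most `|H|`, for every `α`
      (∀ b : ℤ → H, IsBijectiveLayering H b →
        MinimizesTheta Λ₀ t α
          {s : ℤ → H | ∃ k' : ℕ, 1 ≤ k' ∧ k' ≤ H.card ∧ Function.Periodic s (k' : ℤ)} b)) ∧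
    -- the face-centred cubic lattice beats the hexagonal close packing of the same density
    (∀ α c t ℓ : ℝ, 0 < α → 0 < c → 0 < t → 0 < ℓ →
      ℓ / t = √3 / √2 → c ^ 3 / 4 = √3 / 2 * t * ℓ ^ 2 →
      theta (scaledFcc c) α < layeredTheta (triangular ℓ) t α (hcpShift ℓ)) := by
  refine ⟨fun n Λ₀ H t α hΛ hH ht hα => ?_,
    fun α c t ℓ hα hc ht hℓ hratio hdens => theta_fcc_lt_hcp hα hc ht hℓ hratio hdens⟩
  have hsum := hΛ.gaussSummable
  have hβ : 1 / (2 * Real.pi * t ^ 2) ≤ α → 1 / 2 ≤ Real.pi * α * t ^ 2 := by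
    intro h
    rw [div_le_iff₀ (by positivity)] at h
    linarith
  exact ⟨fun s x => (hasSum_layering hsum ht hα _ x).1,
    fun h b hb => isBijectiveLayering_minimizes_periodic hsum ht hα hH (hβ h) hb,
    fun h s hs => minimizer_periodic_unique hsum ht hα hH (hβ h.le) hs,
    fun b hb => isBijectiveLayering_minimizes_short hsum ht hα hH hb⟩
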